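/- Let $k$ be a commutative unital ring; algebras are associative $k$-algebras, not necessarily unital, and a product $S\cdot T$ of $k$-submodules of an algebra is the $k$-span of the products $st$, $s\in S$, $t\in T$. An algebra $R$ has *orthogonal local units* if there is a set $E\subseteq R$ of pairwise orthogonal idempotents with $R=\bigoplus_{e\in E}Re=\bigoplus_{e\in E}eR$. The *multiplier algebra* $\mathcal M(R)$ consists of the pairs $w=(\rho,\lambda)$ of $k$-linear maps $R\to R$, written $aw=\rho(a)$, $wa=\lambda(a)$, with $(ab)w=a(bw)$, $w(ab)=(wa)b$ and $(aw)b=a(wb)$; products are given by $a(ww')=(aw)w'$ and $(ww')a=w(w'a)$. A *twisted partial action* $\Theta$ of a group $G$ on an algebra $A$ consists of two-sided ideals $D_g$ of $A$, $k$-algebra isomorphisms $\theta_g:D_{g^{-1}}\to D_g$ ($g\in G$) and invertible multipliers $w_{g,h}\in\mathcal M(D_g\cdot D_{gh})$ ($g,h\in G$) such that for all $g,h,t\in G$: (i) $D_g\cdot D_g=D_g$ and $D_g\cdot D_h=D_h\cdot D_g$; (ii) $D_1=A$ and $\theta_1=\mathrm{id}_A$; (iii) $\theta_g(D_{g^{-1}}\cdot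 D_h)=D_g\cdot D_{gh}$; (iv) $\theta_g(\theta_h(a))=w_{g,h}\,\theta_{gh}(a)\,w_{g,h}^{-1}$ for $a\in D_{h^{-1}}\cdot D_{h^{-1}g^{-1}}$; (v) $w_{1,g}=w_{g,1}=1$; (vi) $\theta_g(a\,w_{h,t})\,w_{g,ht}=\theta_g(a)\,w_{g,h}\,w_{gh,t}$ for $a\in D_{g^{-1}}\cdot D_h\cdot D_{ht}$. The *crossed product* $A\rtimes_\Theta G$ is $\bigoplus_{g\in G}D_g\delta_g$ with the $k$-bilinear multiplication $(a\delta_g)(b\delta_h)=\theta_g(\theta_g^{-1}(a)\,b)\,w_{g,h}\,\delta_{gh}$, its $g$-homogeneous component being $D_g\delta_g$. For a set $X$, $\mathrm{FMat}_X(R)$ is the algebra of $X\times X$-matrices over $R$ with only finitely many non-zero entries. **Theorem.** Let $G$ be a group and let $B=\bigoplus_{g\in G}B_g$ be a $G$-graded algebra such that $B_g\cdot B_{g^{-1}}\cdot B_g=B_g$ for all $g\in G$ and such that for every $g\in G$ the algebra $B_g\cdot B_{g^{-1}}$ has orthogonal local units. Then there exist an infinite set $X$ and a twisted partial action $\Theta$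 of $G$ on $\mathrm{FMat}_X(B_1)$ such that $$\mathrm{FMat}_X(B)\cong \mathrm{FMat}_X(B_1)\rtimes_\Theta G$$ as graded algebras, the $g$-homogeneous component of $\mathrm{FMat}_X(B)$ being $\mathrm{FMat}_X(B_g)$, $g\in G$; that is, there is an isomorphism of $k$-algebras that maps $\mathrm{FMat}_X(B_g)$ onto $D_g\delta_g$ for every $g\in G$. -/

import Mathlib

universe u v w

open scoped DirectSum

noncomputable section

/-! All algebras are associative, not necessarily unital, over a commutative unital ring `k`. -/

section Products

variable {k A : Type*} [CommRing k] [NonUnitalRing A] [Module k A] [IsScalarTower k A A]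
  [SMulCommClass k A A]

/-- The product `S · T` of two `k`-submodules: the `k`-span of the products `s * t`. -/
def spanMul (S T : Submodule k A) : Submodule k A :=
  Submodule.map₂ (LinearMap.mul k A) S T

infixl:70 " ⊙ " => spanMul

theorem mul_mem_spanMul {S T : Submodule k A} {s t : A} (hs : s ∈ S) (ht : t ∈ T) :
    s * t ∈ S ⊙ T :=
  Submodule.apply_mem_map₂ (LinearMap.mul k A) hs ht

theorem spanMul_le {S T P : Submodule k A} :
    S ⊙ T ≤ P ↔ ∀ s ∈ S, ∀ t ∈ T, s * t ∈ P :=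
  Submodule.map₂_le

theorem spanMul_mono {S S' T T' : Submodule k A} (hS : S ≤ S') (hT : T ≤ T') :
    S ⊙ T ≤ S' ⊙ T' :=
  Submodule.map₂_le_map₂ hS hT

theorem spanMul_assoc (S T P : Submodule k A) : S ⊙ T ⊙ P = S ⊙ (T ⊙ P) := by
  apply le_antisymm
  · rw [spanMul_le]
    intro x hx p hp
    have : S ⊙ T ≤ (S ⊙ (T ⊙ P)).comap (LinearMap.mulRight k p) := by
      rw [spanMul_le]
      intro s hs t ht
      simp only [Submodule.mem_comap, LinearMap.mulRight_apply, mul_assoc]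
      exact mul_mem_spanMul hs (mul_mem_spanMul ht hp)
    exact this hx
  · rw [spanMul_le]
    intro s hs x hx
    have : T ⊙ P ≤ (S ⊙ T ⊙ P).comap (LinearMap.mulLeft k s) := by
      rw [spanMul_le]
      intro t ht p hp
      simp only [Submodule.mem_comap, LinearMap.mulLeft_apply, ← mul_assoc]
      exact mul_mem_spanMul (mul_mem_spanMul hs ht) hp
    exact this hx

end Products

/-- An isomorphism of (not necessarily unital) `k`-algebras. -/
structure NAlgIso (k A B : Type*) [CommRing k] [AddCommMonoid A] [AddCommMonoid B]
    [Module k A] [Module k B] [Mul A] [Mul B] extends A ≃ₗ[k] B where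
  map_mul' : ∀ a b : A, toFun (a * b) = toFun a * toFun b

/-! ### Multipliers -/

/-- A multiplier `w = (R, L)` of an algebra `I`; `right a` is `a w` and `left a` is `w a`. -/
@[ext]
structure Multiplier (k I : Type*) [CommRing k] [NonUnitalRing I] [Module k I] where
  right : I →ₗ[k] I
  left : I →ₗ[k] I
  right_mul : ∀ a b : I, right (a * b) = a * right b
  left_mul : ∀ a b : I, left (a * b) = left a * b
  right_left : ∀ a b : I, right a * b = a * left b

namespace Multiplier

variable {k I : Type*} [CommRing k] [NonUnitalRing I] [Module k I]

/-- The product of multipliers: `a (w w') = (a w) w'` and `(w w') a = w (w' a)`. -/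
instance : Monoid (Multiplier k I) where
  mul w w' :=
    { right := w'.right ∘ₗ w.right
      left := w.left ∘ₗ w'.left
      right_mul := fun a b => by simp [w.right_mul, w'.right_mul]
      left_mul := fun a b => by simp [w.left_mul, w'.left_mul]
      right_left := fun a b => by simp [w.right_left, w'.right_left] }
  one :=
    { right := LinearMap.id
      left := LinearMap.id
      right_mul := fun _ _ => rfl
      left_mul := fun _ _ => rfl
      right_left := fun _ _ => rfl }
  mul_assoc _ _ _ := rfl
  one_mul _ := rfl
  mul_one _ := rfl

end Multiplier

/-! ### Two-sided ideals -/

/-- A two-sided ideal of the `k`-algebra `A`. -/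
structure AlgIdeal (k A : Type*) [CommRing k] [NonUnitalRing A] [Module k A] extends
    Submodule k A where
  mul_mem_left' : ∀ (a : A) {x : A}, x ∈ carrier → a * x ∈ carrier
  mul_mem_right' : ∀ (a : A) {x : A}, x ∈ carrier → x * a ∈ carrier

namespace AlgIdeal

section Basic

variable {k A : Type*} [CommRing k] [NonUnitalRing A] [Module k A]

instance : SetLike (AlgIdeal k A) A where
  coe I := I.carrier
  coe_injective I J h := by
    obtain ⟨I, _, _⟩ := I
    obtain ⟨J, _, _⟩ := J
    obtain rfl : I = J := SetLike.coe_injective h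
    rfl

instance : PartialOrder (AlgIdeal k A) := PartialOrder.ofSetLike (AlgIdeal k A) A

instance : NonUnitalSubringClass (AlgIdeal k A) A where
  add_mem {I} := I.add_mem'
  zero_mem I := I.zero_mem'
  neg_mem {I} _ hx := I.toSubmodule.neg_mem hx
  mul_mem {I} a _ _ hb := I.mul_mem_left' a hb

instance : SMulMemClass (AlgIdeal k A) k A where
  smul_mem {I} c _ hx := I.smul_mem' c hx

end Basic

variable {k A : Type*} [CommRing k] [NonUnitalRing A] [Module k A] [IsScalarTower k A A]
  [SMulCommClass k A A]

/-- The product of two ideals, i.e. the `k`-span of the products of their elements. -/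
instance : Mul (AlgIdeal k A) where
  mul I J :=
    { toSubmodule := I.toSubmodule ⊙ J.toSubmodule
      mul_mem_left' := fun a x hx => by
        have : I.toSubmodule ⊙ J.toSubmodule ≤
            (I.toSubmodule ⊙ J.toSubmodule).comap (LinearMap.mulLeft k a) := by
          rw [spanMul_le]
          intro s hs t ht
          simp only [Submodule.mem_comap, LinearMap.mulLeft_apply, ← mul_assoc]
          exact mul_mem_spanMul (I.mul_mem_left' a hs) ht
        exact this hx
      mul_mem_right' := fun a x hx => by
        have : I.toSubmodule ⊙ J.toSubmodule ≤
            (I.toSubmodule ⊙ J.toSubmodule).comap (LinearMap.mulRight k a) := by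
          rw [spanMul_le]
          intro s hs t ht
          simp only [Submodule.mem_comap, LinearMap.mulRight_apply, mul_assoc]
          exact mul_mem_spanMul hs (J.mul_mem_right' a ht)
        exact this hx }

theorem mul_mem_mul {I J : AlgIdeal k A} {x y : A} (hx : x ∈ I) (hy : y ∈ J) :
    x * y ∈ I * J :=
  mul_mem_spanMul (S := I.toSubmodule) (T := J.toSubmodule) hx hy

theorem mul_le {I J : AlgIdeal k A} {P : Submodule k A} :
    (I * J).toSubmodule ≤ P ↔ ∀ x ∈ I, ∀ y ∈ J, x * y ∈ P :=
  spanMul_le (S := I.toSubmodule) (T := J.toSubmodule)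

theorem mul_le_left {I J : AlgIdeal k A} : I * J ≤ I :=
  mul_le.2 fun _ hx y _ => I.mul_mem_right' y hx

theorem mul_le_right {I J : AlgIdeal k A} : I * J ≤ J :=
  mul_le.2 fun x _ _ hy => J.mul_mem_left' x hy

theorem mul_mono {I I' J J' : AlgIdeal k A} (hI : I ≤ I') (hJ : J ≤ J') :
    I * J ≤ I' * J' :=
  mul_le.2 fun _ hx _ hy => mul_mem_mul (hI hx) (hJ hy)

theorem mul_assoc' (I J K : AlgIdeal k A) : I * J * K = I * (J * K) :=
  SetLike.coe_injective (congrArg (fun S : Submodule k A => (S : Set A))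
    (spanMul_assoc I.toSubmodule J.toSubmodule K.toSubmodule))

/-- A multiplier of an idempotent ideal `I` preserves `J * I`. -/
theorem right_mem {I J : AlgIdeal k A} (hI : I * I = I) (w : Multiplier k I) (a : I)
    (ha : (a : A) ∈ J * I) : (w.right a : A) ∈ J * I := by
  let P : Submodule k A :=
    ((J * I).toSubmodule.comap (I.toSubmodule.subtype ∘ₗ w.right)).map I.toSubmodule.subtype
  have key : (J * I).toSubmodule ≤ P := by
    have h2 : J * I = J * I * I := by rw [mul_assoc', hI]
    rw [h2, mul_le]
    intro x hx y hy
    have hxI : x ∈ I := mul_le_right hx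
    refine ⟨(⟨x, hxI⟩ : I) * ⟨y, hy⟩, ?_, rfl⟩
    change (w.right ((⟨x, hxI⟩ : I) * ⟨y, hy⟩) : A) ∈ J * I
    rw [w.right_mul]
    exact (J * I).mul_mem_right' _ hx
  obtain ⟨b, hb, hba⟩ := key ha
  obtain rfl : b = a := Subtype.ext hba
  exact hb

end AlgIdeal

/-! ### Twisted partial actions and their crossed products -/

/-- The domains and the isomorphisms of a twisted partial action, with the axioms that do not
involve the twisting. -/
structure PartialActionData (k G A : Type*) [CommRing k] [Group G] [NonUnitalRing A]
    [Module k A] [IsScalarTower k A A] [SMulCommClass k A A] where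
  D : G → AlgIdeal k A
  θ : ∀ g, NAlgIso k (D g⁻¹) (D g)
  D_mul_self : ∀ g, D g * D g = D g
  D_mul_comm : ∀ g h, D g * D h = D h * D g
  mem_D_one : ∀ a, a ∈ D 1
  θ_one : ∀ a : D (1 : G)⁻¹, ((θ 1).toLinearEquiv a : A) = a
  map_θ : ∀ g h,
    (fun a : D g⁻¹ => ((θ g).toLinearEquiv a : A)) '' {a | (a : A) ∈ D g⁻¹ * D h} =
      ((D g * D (g * h) : AlgIdeal k A) : Set A)

namespace PartialActionData

variable {k G A : Type*} [CommRing k] [Group G] [NonUnitalRing A]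
    [Module k A] [IsScalarTower k A A] [SMulCommClass k A A] (Θ : PartialActionData k G A)

theorem θ_mem {g h : G} {a : A} (ha : a ∈ Θ.D g⁻¹ * Θ.D h) :
    ((Θ.θ g).toLinearEquiv ⟨a, AlgIdeal.mul_le_left ha⟩ : A) ∈ Θ.D g * Θ.D (g * h) := by
  rw [← SetLike.mem_coe, ← Θ.map_θ]
  exact ⟨⟨a, AlgIdeal.mul_le_left ha⟩, ha, rfl⟩

theorem mul_idem (g h : G) : Θ.D g * Θ.D h * (Θ.D g * Θ.D h) = Θ.D g * Θ.D h := by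
  rw [AlgIdeal.mul_assoc', ← AlgIdeal.mul_assoc' (Θ.D h), Θ.D_mul_comm h g,
    AlgIdeal.mul_assoc', Θ.D_mul_self, ← AlgIdeal.mul_assoc', Θ.D_mul_self]

theorem θ_mem₃ {g h f : G} {a : A} (ha : a ∈ Θ.D g⁻¹ * Θ.D h * Θ.D f) (h' : a ∈ Θ.D g⁻¹) :
    ((Θ.θ g).toLinearEquiv ⟨a, h'⟩ : A) ∈ Θ.D (g * f) * (Θ.D g * Θ.D (g * h)) := by
  let Q := Θ.D (g * f) * (Θ.D g * Θ.D (g * h))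
  let P : Submodule k A :=
    (Q.toSubmodule.comap ((Θ.D g).toSubmodule.subtype ∘ₗ
      ((Θ.θ g).toLinearEquiv : Θ.D g⁻¹ →ₗ[k] Θ.D g))).map (Θ.D g⁻¹).toSubmodule.subtype
  have e : Θ.D g⁻¹ * Θ.D h * Θ.D f = Θ.D g⁻¹ * Θ.D f * (Θ.D g⁻¹ * Θ.D h) := by
    rw [AlgIdeal.mul_assoc' _ (Θ.D f), ← AlgIdeal.mul_assoc' (Θ.D f), Θ.D_mul_comm f,
      AlgIdeal.mul_assoc' _ (Θ.D f), ← AlgIdeal.mul_assoc' _ _ (Θ.D f * _), Θ.D_mul_self,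
      Θ.D_mul_comm f, AlgIdeal.mul_assoc']
  have key : (Θ.D g⁻¹ * Θ.D h * Θ.D f).toSubmodule ≤ P := by
    rw [e, AlgIdeal.mul_le]
    intro x hx y hy
    refine ⟨(⟨x, AlgIdeal.mul_le_left hx⟩ : Θ.D g⁻¹) * ⟨y, AlgIdeal.mul_le_left hy⟩, ?_, rfl⟩
    have := (Θ.θ g).map_mul' ⟨x, AlgIdeal.mul_le_left hx⟩ ⟨y, AlgIdeal.mul_le_left hy⟩
    change (((Θ.θ g).toFun _ : Θ.D g) : A) ∈ Q
    rw [this]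
    exact AlgIdeal.mul_mem_mul (AlgIdeal.mul_le_right (Θ.θ_mem hx)) (Θ.θ_mem hy)
  obtain ⟨b, hb, hba⟩ := key ha
  obtain rfl : b = ⟨a, h'⟩ := Subtype.ext hba
  exact hb

theorem conj_mem₁ {g h : G} {a : A} (ha : a ∈ Θ.D h⁻¹ * Θ.D (h⁻¹ * g⁻¹)) :
    ((Θ.θ h).toLinearEquiv ⟨a, AlgIdeal.mul_le_left ha⟩ : A) ∈ Θ.D g⁻¹ := by
  have := AlgIdeal.mul_le_right (Θ.θ_mem ha)
  rwa [mul_inv_cancel_left] at this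

theorem conj_mem₂ {g h : G} {a : A} (ha : a ∈ Θ.D h⁻¹ * Θ.D (h⁻¹ * g⁻¹)) :
    a ∈ Θ.D (g * h)⁻¹ := by
  have := AlgIdeal.mul_le_right ha
  rwa [← mul_inv_rev] at this

theorem conj_mem₃ {g h : G} {a : A} (ha : a ∈ Θ.D h⁻¹ * Θ.D (h⁻¹ * g⁻¹)) :
    ((Θ.θ (g * h)).toLinearEquiv ⟨a, Θ.conj_mem₂ ha⟩ : A) ∈ Θ.D g * Θ.D (g * h) := by
  have h1 : a ∈ Θ.D (g * h)⁻¹ * Θ.D h⁻¹ := by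
    rw [← mul_inv_rev] at ha
    rwa [Θ.D_mul_comm]
  have := Θ.θ_mem h1
  rwa [mul_inv_cancel_right, Θ.D_mul_comm] at this

theorem cocycle_mem₁ {g h f : G} {a : A} (ha : a ∈ Θ.D g⁻¹ * Θ.D h * Θ.D f) :
    a ∈ Θ.D h * Θ.D f := by
  rw [AlgIdeal.mul_assoc'] at ha
  exact AlgIdeal.mul_le_right ha

theorem cocycle_mem₂ {g h f : G} {a : A} (ha : a ∈ Θ.D g⁻¹ * Θ.D h * Θ.D f)
    (w : Multiplier k ↥(Θ.D h * Θ.D f)) :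
    (w.right ⟨a, Θ.cocycle_mem₁ ha⟩ : A) ∈ Θ.D g⁻¹ * Θ.D f := by
  have h1 := AlgIdeal.right_mem (J := Θ.D g⁻¹) (Θ.mul_idem h f) w ⟨a, Θ.cocycle_mem₁ ha⟩
    (by rwa [AlgIdeal.mul_assoc'] at ha)
  exact AlgIdeal.mul_mono le_rfl AlgIdeal.mul_le_right h1

theorem cocycle_mem₃ {g h f : G} {a : A} (ha : a ∈ Θ.D g⁻¹ * Θ.D h * Θ.D f)
    (w : Multiplier k ↥(Θ.D g * Θ.D (g * h))) :
    (w.right ⟨(Θ.θ g).toLinearEquiv ⟨a, AlgIdeal.mul_le_left (AlgIdeal.mul_le_left ha)⟩,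
      Θ.θ_mem (AlgIdeal.mul_le_left ha)⟩ : A) ∈ Θ.D (g * h) * Θ.D (g * f) := by
  have h1 := AlgIdeal.right_mem (J := Θ.D (g * f)) (Θ.mul_idem g (g * h)) w
    ⟨_, Θ.θ_mem (AlgIdeal.mul_le_left ha)⟩ (Θ.θ_mem₃ ha _)
  rw [Θ.D_mul_comm (g * h)]
  exact AlgIdeal.mul_mono le_rfl AlgIdeal.mul_le_right h1

end PartialActionData

/-- A twisted partial action `Θ = ({D_g}, {θ_g}, {w_{g,h}})` of `G` on the algebra `A`. The anonymous
membership proofs say that all maps below are applied to elements of their domains. -/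
structure TwistedPartialAction (k G A : Type*) [CommRing k] [Group G] [NonUnitalRing A]
    [Module k A] [IsScalarTower k A A] [SMulCommClass k A A] extends
    PartialActionData k G A where
  w : ∀ g h : G, (Multiplier k ↥(D g * D (g * h)))ˣ
  /-- `θ_g (θ_h a) = w_{g,h} (θ_{gh} a) w_{g,h}⁻¹` for `a ∈ D_{h⁻¹} · D_{h⁻¹ g⁻¹}`. -/
  conj : ∀ (g h : G) (a : A) (ha : a ∈ D h⁻¹ * D (h⁻¹ * g⁻¹)),
    ((θ g).toLinearEquiv ⟨(θ h).toLinearEquiv ⟨a, AlgIdeal.mul_le_left ha⟩,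
        toPartialActionData.conj_mem₁ ha⟩ : A) =
      (w g h)⁻¹.val.right ((w g h).val.left
        ⟨(θ (g * h)).toLinearEquiv ⟨a, toPartialActionData.conj_mem₂ ha⟩,
          toPartialActionData.conj_mem₃ ha⟩)
  w_one_left : ∀ g : G, w 1 g = 1
  w_one_right : ∀ g : G, w g 1 = 1
  /-- `θ_g (a w_{h,t}) w_{g,ht} = θ_g (a) w_{g,h} w_{gh,t}` for
  `a ∈ D_{g⁻¹} · D_h · D_{ht}`. -/
  cocycle : ∀ (g h t : G) (a : A) (ha : a ∈ D g⁻¹ * D h * D (h * t)),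
    ((w g (h * t)).val.right
      ⟨(θ g).toLinearEquiv ⟨(w h t).val.right ⟨a, toPartialActionData.cocycle_mem₁ ha⟩,
          AlgIdeal.mul_le_left (toPartialActionData.cocycle_mem₂ ha (w h t).val)⟩,
        toPartialActionData.θ_mem (toPartialActionData.cocycle_mem₂ ha (w h t).val)⟩ : A) =
      (w (g * h) t).val.right
        ⟨(w g h).val.right
          ⟨(θ g).toLinearEquiv ⟨a, AlgIdeal.mul_le_left (AlgIdeal.mul_le_left ha)⟩,
            toPartialActionData.θ_mem (AlgIdeal.mul_le_left ha)⟩,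
          (mul_assoc g h t).symm ▸ toPartialActionData.cocycle_mem₃ ha (w g h).val⟩

namespace TwistedPartialAction

variable {k G A : Type*} [CommRing k] [Group G] [NonUnitalRing A]
    [Module k A] [IsScalarTower k A A] [SMulCommClass k A A] (Θ : TwistedPartialAction k G A)

/-- The product of `A`, as a bilinear map `D_{g⁻¹} × D_h → D_{g⁻¹} · D_h`. -/
def pairing (g h : G) : Θ.D g⁻¹ →ₗ[k] Θ.D h →ₗ[k] ↥(Θ.D g⁻¹ * Θ.D h) :=
  LinearMap.mk₂ k (fun a b => ⟨a * b, AlgIdeal.mul_mem_mul a.2 b.2⟩)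
    (fun _ _ _ => Subtype.ext (add_mul _ _ _)) (fun _ _ _ => Subtype.ext (smul_mul_assoc _ _ _))
    (fun _ _ _ => Subtype.ext (mul_add _ _ _)) (fun _ _ _ => Subtype.ext (mul_smul_comm _ _ _))

/-- The restriction `D_{g⁻¹} · D_h → D_g · D_{gh}` of `θ_g`. -/
def θRestrict (g h : G) : ↥(Θ.D g⁻¹ * Θ.D h) →ₗ[k] ↥(Θ.D g * Θ.D (g * h)) where
  toFun a := ⟨(Θ.θ g).toLinearEquiv ⟨a, AlgIdeal.mul_le_left a.2⟩, Θ.θ_mem a.2⟩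
  map_add' a b := Subtype.ext (congrArg (fun z : Θ.D g => (z : A))
    ((Θ.θ g).toLinearEquiv.map_add ⟨a, AlgIdeal.mul_le_left a.2⟩ ⟨b, AlgIdeal.mul_le_left b.2⟩))
  map_smul' c a := Subtype.ext (congrArg (fun z : Θ.D g => (z : A))
    ((Θ.θ g).toLinearEquiv.map_smul c ⟨a, AlgIdeal.mul_le_left a.2⟩))

/-- The inclusion `D_g · D_{gh} ⊆ D_{gh}`. -/
def inclusion (g h : G) : ↥(Θ.D g * Θ.D (g * h)) →ₗ[k] Θ.D (g * h) where
  toFun a := ⟨a, AlgIdeal.mul_le_right a.2⟩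
  map_add' _ _ := rfl
  map_smul' _ _ := rfl

/-- `(a, b) ↦ θ_g (θ_g⁻¹ (a) b) w_{g,h}`, for `a ∈ D_g` and `b ∈ D_h`. -/
def mulComponent (g h : G) : Θ.D g →ₗ[k] Θ.D h →ₗ[k] Θ.D (g * h) :=
  (Θ.pairing g h ∘ₗ ((Θ.θ g).toLinearEquiv.symm : Θ.D g →ₗ[k] Θ.D g⁻¹)).compr₂
    (Θ.inclusion g h ∘ₗ (Θ.w g h).val.right ∘ₗ Θ.θRestrict g h)

/-- The crossed product `A ⋊_Θ G = ⨁_g D_g δ_g`. -/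
def CrossedProduct : Type _ := ⨁ g : G, Θ.D g

namespace CrossedProduct

instance : AddCommGroup Θ.CrossedProduct := inferInstanceAs (AddCommGroup (⨁ g : G, Θ.D g))

instance : Module k Θ.CrossedProduct := inferInstanceAs (Module k (⨁ g : G, Θ.D g))

variable [DecidableEq G]

/-- `a ↦ a δ_g`, for `a ∈ D_g`. -/
def δ (g : G) : Θ.D g →ₗ[k] Θ.CrossedProduct := DirectSum.lof k G (fun g => Θ.D g) g

/-- The bilinear map with `(a δ_g, b δ_h) ↦ θ_g (θ_g⁻¹ (a) b) w_{g,h} δ_{gh}`. -/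
def mulHom : Θ.CrossedProduct →ₗ[k] Θ.CrossedProduct →ₗ[k] Θ.CrossedProduct :=
  DirectSum.toModule k G _ fun g => LinearMap.flip <|
    DirectSum.toModule k G _ fun h => LinearMap.flip <|
      (Θ.mulComponent g h).compr₂ (δ Θ (g * h))

instance : NonUnitalNonAssocRing Θ.CrossedProduct where
  mul x y := mulHom Θ x y
  left_distrib x := (mulHom Θ x).map_add
  right_distrib := (mulHom Θ).map_add₂
  zero_mul := (mulHom Θ).map_zero₂
  mul_zero x := (mulHom Θ x).map_zero

theorem δ_mul_δ (g h : G) (a : Θ.D g) (b : Θ.D h) :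
    δ Θ g a * δ Θ h b = δ Θ (g * h) (Θ.mulComponent g h a b) := by
  change mulHom Θ (δ Θ g a) (δ Θ h b) = _
  unfold mulHom δ
  erw [DirectSum.toModule_lof, LinearMap.flip_apply, DirectSum.toModule_lof]
  rfl

end CrossedProduct

end TwistedPartialAction

/-! ### Matrices with finitely many non-zero entries -/

/-- The `X × X`-matrices over `R` with only finitely many non-zero entries. -/
def FMat (X R : Type*) [Zero R] : Type _ := X × X →₀ R

namespace FMat

section Ring

variable {X R : Type*} [NonUnitalRing R]

instance : AddCommGroup (FMat X R) := inferInstanceAs (AddCommGroup (X × X →₀ R))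

/-- The `(x, y)`-entry of a matrix. -/
def entry (a : FMat X R) (x y : X) : R := (show X × X →₀ R from a) (x, y)

@[ext]
theorem ext {a b : FMat X R} (h : ∀ x y, a.entry x y = b.entry x y) : a = b :=
  Finsupp.ext fun p => h p.1 p.2

theorem entry_zero (x y : X) : (0 : FMat X R).entry x y = 0 := rfl

theorem entry_add (a b : FMat X R) (x y : X) :
    (a + b).entry x y = a.entry x y + b.entry x y := rfl

open Classical in
/-- The finite set of (indices of) non-zero columns. -/
def cols (a : FMat X R) : Finset X := (show X × X →₀ R from a).support.image Prod.snd

theorem entry_eq_zero {a : FMat X R} {x y : X} (h : y ∉ a.cols) : a.entry x y = 0 := by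
  classical
  by_contra h'
  exact h (Finset.mem_image.2 ⟨(x, y), Finsupp.mem_support_iff.2 h', rfl⟩)

open Classical in
/-- Matrix multiplication; the sum over the middle index runs over the non-zero columns of the
first factor. -/
instance : Mul (FMat X R) where
  mul a b := Finsupp.onFinset
    ((show X × X →₀ R from a).support.image Prod.fst ×ˢ b.cols)
    (fun p => ∑ y ∈ a.cols, a.entry p.1 y * b.entry y p.2) (by
      intro p hp
      obtain ⟨y, -, hy⟩ := Finset.exists_ne_zero_of_sum_ne_zero hp
      refine Finset.mem_product.2 ⟨Finset.mem_image.2 ⟨(p.1, y),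
        Finsupp.mem_support_iff.2 (left_ne_zero_of_mul hy), rfl⟩, ?_⟩
      by_contra h
      exact right_ne_zero_of_mul hy (entry_eq_zero h))

theorem entry_mul (a b : FMat X R) (x z : X) :
    (a * b).entry x z = ∑ y ∈ a.cols, a.entry x y * b.entry y z := rfl

theorem entry_mul_of_subset (a b : FMat X R) (x z : X) {S : Finset X} (hS : a.cols ⊆ S) :
    (a * b).entry x z = ∑ y ∈ S, a.entry x y * b.entry y z := by
  rw [entry_mul]
  exact Finset.sum_subset hS fun y _ hy => by rw [entry_eq_zero hy, zero_mul]

instance : NonUnitalRing (FMat X R) where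
  left_distrib a b c := by
    ext x z
    simp only [entry_mul, entry_add, mul_add, Finset.sum_add_distrib]
  right_distrib a b c := by
    classical
    ext x z
    have h1 : (a + b).cols ⊆ a.cols ∪ b.cols ∪ (a + b).cols := Finset.subset_union_right
    have h2 : a.cols ⊆ a.cols ∪ b.cols ∪ (a + b).cols :=
      Finset.subset_union_left.trans Finset.subset_union_left
    have h3 : b.cols ⊆ a.cols ∪ b.cols ∪ (a + b).cols :=
      Finset.subset_union_right.trans Finset.subset_union_left
    simp only [entry_add, entry_mul_of_subset _ _ _ _ h1, entry_mul_of_subset _ _ _ _ h2,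
      entry_mul_of_subset _ _ _ _ h3, add_mul, Finset.sum_add_distrib]
  zero_mul a := by
    ext x z
    simp [entry_mul, entry_zero]
  mul_zero a := by
    ext x z
    simp [entry_mul, entry_zero]
  mul_assoc a b c := by
    classical
    ext x z
    have h1 : (a * b).cols ⊆ b.cols ∪ (a * b).cols := Finset.subset_union_right
    have h2 : b.cols ⊆ b.cols ∪ (a * b).cols := Finset.subset_union_left
    rw [entry_mul_of_subset _ _ _ _ h1, entry_mul]
    simp only [entry_mul_of_subset b c _ _ h2, entry_mul a b, Finset.sum_mul, Finset.mul_sum,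
      mul_assoc]
    exact Finset.sum_comm

end Ring

section Algebra

variable {X k R : Type*} [CommRing k] [NonUnitalRing R] [Module k R]

instance : Module k (FMat X R) := inferInstanceAs (Module k (X × X →₀ R))

theorem entry_smul (c : k) (a : FMat X R) (x y : X) :
    (c • a).entry x y = c • a.entry x y := rfl

instance [IsScalarTower k R R] : IsScalarTower k (FMat X R) (FMat X R) where
  smul_assoc c a b := by
    classical
    ext x z
    have h1 : (c • a).cols ⊆ a.cols ∪ (c • a).cols := Finset.subset_union_right
    have h2 : a.cols ⊆ a.cols ∪ (c • a).cols := Finset.subset_union_left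
    simp only [smul_eq_mul, entry_smul, entry_mul_of_subset _ _ _ _ h1,
      entry_mul_of_subset _ _ _ _ h2, Finset.smul_sum, smul_mul_assoc]

instance [SMulCommClass k R R] : SMulCommClass k (FMat X R) (FMat X R) where
  smul_comm c a b := by
    ext x z
    simp only [smul_eq_mul, entry_smul, entry_mul, Finset.smul_sum, mul_smul_comm]

/-- `FMat_X(S)` inside `FMat_X(R)`, for a submodule `S` of `R`. -/
def component (X : Type*) (S : Submodule k R) : Submodule k (FMat X R) where
  carrier := {a | ∀ x y, a.entry x y ∈ S}
  add_mem' ha hb x y := S.add_mem (ha x y) (hb x y)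
  zero_mem' _ _ := S.zero_mem
  smul_mem' c _ ha x y := S.smul_mem c (ha x y)

end Algebra

end FMat

/-! ### Graded algebras with enough local units -/

/-- `R` has orthogonal local units: there is a set `E` of pairwise orthogonal idempotents of `R`
with `R = ⨁_{e ∈ E} R e = ⨁_{e ∈ E} e R`. -/
def HasOrthogonalLocalUnits (k R : Type*) [CommRing k] [NonUnitalRing R] [Module k R]
    [IsScalarTower k R R] [SMulCommClass k R R] : Prop :=
  open scoped Classical in
  ∃ E : Set R, (∀ e ∈ E, e * e = e) ∧ (∀ e ∈ E, ∀ f ∈ E, e ≠ f → e * f = 0) ∧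
    DirectSum.IsInternal (fun e : E => LinearMap.range (LinearMap.mulRight k (e : R))) ∧
    DirectSum.IsInternal (fun e : E => LinearMap.range (LinearMap.mulLeft k (e : R)))

section Graded

variable {k G B : Type*} [CommRing k] [Group G] [DecidableEq G] [NonUnitalRing B]
    [Module k B] [IsScalarTower k B B] [SMulCommClass k B B]

/-- `B = ⨁_g B_g` is a `G`-graded algebra: `B_g B_h ⊆ B_{gh}`. -/
structure IsGrading (𝓑 : G → Submodule k B) : Prop where
  internal : DirectSum.IsInternal 𝓑
  mul_mem : ∀ {g h : G} {a b : B}, a ∈ 𝓑 g → b ∈ 𝓑 h → a * b ∈ 𝓑 (g * h)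

namespace IsGrading

variable {𝓑 : G → Submodule k B} (h𝓑 : IsGrading 𝓑)

/-- The algebra `B_1`. -/
def unitComponent : NonUnitalSubalgebra k B where
  toNonUnitalSubsemiring :=
    { carrier := 𝓑 1
      add_mem' := (𝓑 1).add_mem
      zero_mem' := (𝓑 1).zero_mem
      mul_mem' := fun ha hb => by simpa using h𝓑.mul_mem ha hb }
  smul_mem' c _ hx := (𝓑 1).smul_mem c hx

/-- The algebra `D_g = B_g · B_{g⁻¹}`. -/
def prodComponent (g : G) : NonUnitalSubalgebra k B where
  toNonUnitalSubsemiring :=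
    { carrier := 𝓑 g ⊙ 𝓑 g⁻¹
      add_mem' := (𝓑 g ⊙ 𝓑 g⁻¹).add_mem
      zero_mem' := (𝓑 g ⊙ 𝓑 g⁻¹).zero_mem
      mul_mem' := fun {a b} ha hb => by
        have h1 : 𝓑 g ⊙ 𝓑 g⁻¹ ≤ 𝓑 1 :=
          spanMul_le.2 fun x hx y hy => by simpa using h𝓑.mul_mem hx hy
        have h2 : 𝓑 g ⊙ 𝓑 g⁻¹ ≤ (𝓑 g ⊙ 𝓑 g⁻¹).comap (LinearMap.mulRight k b) := by
          refine spanMul_le.2 fun x hx y hy => ?_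
          simp only [Submodule.mem_comap, LinearMap.mulRight_apply, mul_assoc]
          exact mul_mem_spanMul hx (by simpa using h𝓑.mul_mem hy (h1 hb))
        exact h2 ha }
  smul_mem' c _ hx := (𝓑 g ⊙ 𝓑 g⁻¹).smul_mem c hx

/-- The graded algebra has enough local units: every `D_g` has orthogonal local units. -/
def HasEnoughLocalUnits : Prop := ∀ g : G, HasOrthogonalLocalUnits k (h𝓑.prodComponent g)

end IsGrading

end Graded

end

/-! Writing the local units of `D_g = B_g ⊙ B_{g⁻¹}` as finite sums of products makes the
multiplication pairing `D_g × D_g` a retract of a direct power of the pairing `B_g × B_{g⁻¹}`, and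
vice versa. By the Eilenberg swindle the direct powers of the two pairings indexed by a large set
`X` are therefore equivalent. Reading the rows and columns of matrices as elements of such powers,
one obtains `C_g = C_g C_{g⁻¹} u_g` for `C_g = FMat_X(B_g)` and a formal invertible multiplier
`u_g`. The twisted partial action is given by `θ_g(y) = u_g y u_g⁻¹` and
`w_{g,h} = u_g u_h u_{gh}⁻¹`, and the isomorphism by `a δ_g ↦ a u_g`. -/

noncomputable section

/-! ### Pairings and the Eilenberg swindle -/

section Pairings

variable {k V : Type*} [CommRing k] [AddCommGroup V] [Module k V]
variable {S S' T T' U U' : Type*}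
  [AddCommGroup S] [Module k S] [AddCommGroup S'] [Module k S']
  [AddCommGroup T] [Module k T] [AddCommGroup T'] [Module k T']
  [AddCommGroup U] [Module k U] [AddCommGroup U'] [Module k U']

/-- Two pairings are equivalent if they are intertwined by a pair of mutually adjoint
isomorphisms. -/
def PairingEquiv (β : S →ₗ[k] S' →ₗ[k] V) (γ : T →ₗ[k] T' →ₗ[k] V) : Prop :=
  ∃ (R : S ≃ₗ[k] T) (L : T' ≃ₗ[k] S'), ∀ s t', γ (R s) t' = β s (L t')

/-- A pairing is a retract of another one, by means of maps that have adjoints. -/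
def PairingRetract (β : S →ₗ[k] S' →ₗ[k] V) (γ : T →ₗ[k] T' →ₗ[k] V) : Prop :=
  ∃ (r : S →ₗ[k] T) (r' : T' →ₗ[k] S') (c : T →ₗ[k] S) (c' : S' →ₗ[k] T'),
    (∀ s t', γ (r s) t' = β s (r' t')) ∧ (∀ t s', β (c t) s' = γ t (c' s')) ∧
    (∀ s, c (r s) = s) ∧ (∀ s', r' (c' s') = s')

namespace PairingEquiv

variable {β : S →ₗ[k] S' →ₗ[k] V} {γ : T →ₗ[k] T' →ₗ[k] V} {ε : U →ₗ[k] U' →ₗ[k] V}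

theorem symm (h : PairingEquiv β γ) : PairingEquiv γ β := by
  obtain ⟨R, L, h⟩ := h
  exact ⟨R.symm, L.symm, fun t s' => by simpa using (h (R.symm t) (L.symm s')).symm⟩

theorem trans (h : PairingEquiv β γ) (h' : PairingEquiv γ ε) : PairingEquiv β ε := by
  obtain ⟨R, L, h⟩ := h
  obtain ⟨R', L', h'⟩ := h'
  exact ⟨R.trans R', L'.trans L, fun s t => by simp [h, h']⟩

theorem retract (h : PairingEquiv β γ) : PairingRetract β γ := by
  obtain ⟨R, L, h⟩ := h
  refine ⟨R.toLinearMap, L.toLinearMap, R.symm.toLinearMap, L.symm.toLinearMap, h,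
    fun t s' => ?_, R.symm_apply_apply, L.apply_symm_apply⟩
  simpa using (h (R.symm t) (L.symm s')).symm

end PairingEquiv

theorem PairingRetract.trans {β : S →ₗ[k] S' →ₗ[k] V} {γ : T →ₗ[k] T' →ₗ[k] V}
    {ε : U →ₗ[k] U' →ₗ[k] V} (h : PairingRetract β γ) (h' : PairingRetract γ ε) :
    PairingRetract β ε := by
  obtain ⟨r, r', c, c', h1, h2, h3, h4⟩ := h
  obtain ⟨q, q', d, d', h1', h2', h3', h4'⟩ := h'
  exact ⟨q ∘ₗ r, r' ∘ₗ q', c ∘ₗ d, d' ∘ₗ c', fun s t' => by simp [h1', h1],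
    fun t s' => by simp [h2, h2'], fun s => by simp [h3, h3'], fun s' => by simp [h4, h4']⟩

/-- The orthogonal sum `β ⊕ γ` of two pairings. -/
def sumPairing (β : S →ₗ[k] S' →ₗ[k] V) (γ : T →ₗ[k] T' →ₗ[k] V) :
    S × T →ₗ[k] S' × T' →ₗ[k] V :=
  LinearMap.coprod ((LinearMap.lcomp k V (LinearMap.fst k S' T')) ∘ₗ β)
    ((LinearMap.lcomp k V (LinearMap.snd k S' T')) ∘ₗ γ)

@[simp]
theorem sumPairing_apply (β : S →ₗ[k] S' →ₗ[k] V) (γ : T →ₗ[k] T' →ₗ[k] V) (x : S × T)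
    (y : S' × T') : sumPairing β γ x y = β x.1 y.1 + γ x.2 y.2 := by
  simp [sumPairing]

/-- The orthogonal sum of copies of the pairing `β`, indexed by `I`. -/
def powPairing (I : Type*) (β : S →ₗ[k] S' →ₗ[k] V) : (I →₀ S) →ₗ[k] (I →₀ S') →ₗ[k] V :=
  Finsupp.lsum k fun i => (LinearMap.lcomp k V (Finsupp.lapply i)) ∘ₗ β

theorem powPairing_apply {I : Type*} (β : S →ₗ[k] S' →ₗ[k] V) (x : I →₀ S) (y : I →₀ S') :
    powPairing I β x y = x.sum fun i s => β s (y i) := by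
  simp [powPairing, Finsupp.sum, LinearMap.sum_apply]

@[simp]
theorem powPairing_single_left {I : Type*} (β : S →ₗ[k] S' →ₗ[k] V) (i : I) (s : S)
    (y : I →₀ S') : powPairing I β (Finsupp.single i s) y = β s (y i) := by
  simp [powPairing]

theorem powPairing_single_right {I : Type*} (β : S →ₗ[k] S' →ₗ[k] V) (x : I →₀ S) (i : I)
    (s' : S') : powPairing I β x (Finsupp.single i s') = β (x i) s' := by
  classical
  induction x using Finsupp.induction_linear with
  | zero => simp
  | add x y hx hy => simp [hx, hy]
  | single j s =>
    rw [powPairing_single_left]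
    by_cases h : i = j
    · subst h; simp
    · simp [h, Ne.symm h]

theorem adjoint_of_single {I : Type*} {β : (I →₀ S) →ₗ[k] S' →ₗ[k] V} {γ : T →ₗ[k] T' →ₗ[k] V}
    (f : (I →₀ S) →ₗ[k] T) (f' : T' → S')
    (h : ∀ i s t', γ (f (Finsupp.single i s)) t' = β (Finsupp.single i s) (f' t'))
    (x : I →₀ S) (t' : T') : γ (f x) t' = β x (f' t') := by
  induction x using Finsupp.induction_linear with
  | zero => simp only [map_zero, LinearMap.zero_apply]
  | add x y hx hy => simp only [map_add, LinearMap.add_apply, hx, hy]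
  | single i s => exact h i s t'

theorem powPairing_reindex {I J : Type*} (e : I ≃ J) (β : S →ₗ[k] S' →ₗ[k] V) :
    PairingEquiv (powPairing I β) (powPairing J β) :=
  ⟨Finsupp.domLCongr e, Finsupp.domLCongr e.symm,
    adjoint_of_single (β := powPairing I β) (γ := powPairing J β)
      (Finsupp.domLCongr e).toLinearMap (Finsupp.domLCongr e.symm)
      fun i s y => by simp [Finsupp.domLCongr_apply]⟩

theorem powPairing_retract_of_embedding {I J : Type*} (f : I ↪ J) (β : S →ₗ[k] S' →ₗ[k] V) :
    PairingRetract (powPairing I β) (powPairing J β) := by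
  refine ⟨Finsupp.lmapDomain S k f, Finsupp.lcomapDomain f f.injective,
    Finsupp.lcomapDomain f f.injective, Finsupp.lmapDomain S' k f,
    adjoint_of_single _ _ fun i s y => by simp, adjoint_of_single _ _ fun j s y => ?_,
    Finsupp.comapDomain_mapDomain f f.injective, Finsupp.comapDomain_mapDomain f f.injective⟩
  by_cases hj : j ∈ Set.range f
  · obtain ⟨i, rfl⟩ := hj
    simp [Finsupp.mapDomain_apply f.injective]
  · have : Finsupp.comapDomain f (Finsupp.single j s) f.injective.injOn = 0 :=
      Finsupp.ext fun i => Finsupp.single_eq_of_ne fun h => hj ⟨i, h⟩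
    simp [this, Finsupp.mapDomain_of_notMem_range _ _ hj]

theorem powPairing_powPairing {I J : Type*} (β : S →ₗ[k] S' →ₗ[k] V) :
    PairingEquiv (powPairing I (powPairing J β)) (powPairing (I × J) β) := by
  refine ⟨(Finsupp.curryLinearEquiv k).symm, Finsupp.curryLinearEquiv k,
    adjoint_of_single (β := powPairing I (powPairing J β)) (γ := powPairing (I × J) β)
      (Finsupp.curryLinearEquiv k).symm.toLinearMap (Finsupp.curryLinearEquiv k) fun i x y => ?_⟩
  rw [powPairing_single_left]
  exact adjoint_of_single (β := powPairing J β) (γ := powPairing (I × J) β)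
    ((Finsupp.curryLinearEquiv k).symm.toLinearMap ∘ₗ Finsupp.lsingle i)
    (fun y => Finsupp.curryLinearEquiv k y i)
    (fun j s y => by simp [Finsupp.curryLinearEquiv]) x y

theorem PairingRetract.pow (I : Type*) {β : S →ₗ[k] S' →ₗ[k] V} {γ : T →ₗ[k] T' →ₗ[k] V}
    (h : PairingRetract β γ) : PairingRetract (powPairing I β) (powPairing I γ) := by
  obtain ⟨r, r', c, c', h1, h2, h3, h4⟩ := h
  exact ⟨Finsupp.mapRange.linearMap r, Finsupp.mapRange.linearMap r',
    Finsupp.mapRange.linearMap c, Finsupp.mapRange.linearMap c',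
    adjoint_of_single _ _ fun i s y => by simp [h1],
    adjoint_of_single _ _ fun i t y => by simp [h2],
    fun s => Finsupp.ext fun i => by simp [h3], fun s => Finsupp.ext fun i => by simp [h4]⟩

/-- The linear map into a finitary direct power whose components are the given linear maps, of
which only finitely many are non-zero at each vector. -/
def locallyFiniteMap {I : Type*} (f : I → S →ₗ[k] T)
    (hf : ∀ s, ∃ F : Finset I, ∀ i ∉ F, f i s = 0) : S →ₗ[k] I →₀ T where
  toFun s := Finsupp.onFinset (hf s).choose (fun i => f i s) fun i hi =>
    not_imp_comm.1 ((hf s).choose_spec i) hi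
  map_add' s t := Finsupp.ext fun i => map_add (f i) s t
  map_smul' a s := Finsupp.ext fun i => map_smul (f i) a s

@[simp]
theorem locallyFiniteMap_apply {I : Type*} (f : I → S →ₗ[k] T)
    (hf : ∀ s, ∃ F : Finset I, ∀ i ∉ F, f i s = 0) (s : S) (i : I) :
    locallyFiniteMap f hf s i = f i s := rfl

theorem lsum_locallyFiniteMap {I : Type*} (f : I → S →ₗ[k] T) (g : I → T →ₗ[k] U)
    (hf : ∀ s, ∃ F : Finset I, ∀ i ∉ F, f i s = 0) {s : S} {F : Finset I}
    (hF : ∀ i ∉ F, f i s = 0) :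
    Finsupp.lsum k g (locallyFiniteMap f hf s) = ∑ i ∈ F, g i (f i s) := by
  rw [Finsupp.lsum_apply, Finsupp.sum_of_support_subset (s := F)]
  · rfl
  · exact fun i hi => not_imp_comm.1 (hF i) (Finsupp.mem_support_iff.1 hi)
  · simp

theorem PairingRetract.of_locallyFinite {I : Type*} {β : S →ₗ[k] S' →ₗ[k] V}
    {γ : T →ₗ[k] T' →ₗ[k] V} (r : I → S →ₗ[k] T) (r' : I → T' →ₗ[k] S') (c : I → T →ₗ[k] S)
    (c' : I → S' →ₗ[k] T') (hr : ∀ i s t', γ (r i s) t' = β s (r' i t'))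
    (hc : ∀ i t s', β (c i t) s' = γ t (c' i s'))
    (left : ∀ s, ∃ F : Finset I, (∀ i ∉ F, r i s = 0) ∧ ∑ i ∈ F, c i (r i s) = s)
    (right : ∀ s', ∃ F : Finset I, (∀ i ∉ F, c' i s' = 0) ∧ ∑ i ∈ F, r' i (c' i s') = s') :
    PairingRetract β (powPairing I γ) := by
  refine ⟨locallyFiniteMap r fun s => (left s).imp fun _ => And.left, Finsupp.lsum k r',
    Finsupp.lsum k c, locallyFiniteMap c' fun s' => (right s').imp fun _ => And.left,
    fun s y => ?_, adjoint_of_single _ _ fun i t s' => by simp [hc], fun s => ?_, fun s' => ?_⟩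
  · induction y using Finsupp.induction_linear with
    | zero => simp only [map_zero]
    | add y z hy hz => simp only [map_add, hy, hz]
    | single i t' => simp [powPairing_single_right, hr]
  · obtain ⟨F, hF, hsum⟩ := left s
    rw [lsum_locallyFiniteMap _ _ _ hF, hsum]
  · obtain ⟨F, hF, hsum⟩ := right s'
    rw [lsum_locallyFiniteMap _ _ _ hF, hsum]

/-- The map `S ⊕ T^ℕ → T^ℕ` of the Eilenberg swindle for a retract `S` of `T`. -/
def swindleMap (r : S →ₗ[k] T) (c : T →ₗ[k] S) : S × (ℕ →₀ T) →ₗ[k] ℕ →₀ T :=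
  LinearMap.coprod (Finsupp.lsingle 0 ∘ₗ r)
    (Finsupp.mapRange.linearMap (LinearMap.id - r ∘ₗ c) +
      Finsupp.lmapDomain T k Nat.succ ∘ₗ Finsupp.mapRange.linearMap (r ∘ₗ c))

/-- The inverse of `swindleMap`. -/
def swindleInv (r : S →ₗ[k] T) (c : T →ₗ[k] S) : (ℕ →₀ T) →ₗ[k] S × (ℕ →₀ T) :=
  LinearMap.prod (c ∘ₗ Finsupp.lapply 0)
    (Finsupp.mapRange.linearMap (LinearMap.id - r ∘ₗ c) +
      Finsupp.mapRange.linearMap (r ∘ₗ c) ∘ₗ Finsupp.lcomapDomain Nat.succ Nat.succ_injective)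

theorem swindleMap_zero (r : S →ₗ[k] T) (c : T →ₗ[k] S) (x : S × (ℕ →₀ T)) :
    swindleMap r c x 0 = r x.1 + (x.2 0 - r (c (x.2 0))) := by
  have : Finsupp.mapDomain Nat.succ (Finsupp.mapRange (r ∘ c) (by simp) x.2) 0 = 0 :=
    Finsupp.mapDomain_of_notMem_range _ _ (by simp)
  simpa [swindleMap] using this

theorem swindleMap_succ (r : S →ₗ[k] T) (c : T →ₗ[k] S) (x : S × (ℕ →₀ T)) (n : ℕ) :
    swindleMap r c x (n + 1) = (x.2 (n + 1) - r (c (x.2 (n + 1)))) + r (c (x.2 n)) := by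
  have := Finsupp.mapDomain_apply Nat.succ_injective
    (Finsupp.mapRange (r ∘ c) (by simp) x.2) n
  simpa [swindleMap] using this

theorem swindleInv_fst (r : S →ₗ[k] T) (c : T →ₗ[k] S) (x : ℕ →₀ T) :
    (swindleInv r c x).1 = c (x 0) := rfl

theorem swindleInv_snd (r : S →ₗ[k] T) (c : T →ₗ[k] S) (x : ℕ →₀ T) (n : ℕ) :
    (swindleInv r c x).2 n = (x n - r (c (x n))) + r (c (x (n + 1))) := rfl

/-- The Eilenberg swindle: if `S` is a retract of `T` then `S ⊕ T^ℕ ≃ T^ℕ`. -/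
def swindle (r : S →ₗ[k] T) (c : T →ₗ[k] S) (h : ∀ s, c (r s) = s) :
    (S × (ℕ →₀ T)) ≃ₗ[k] (ℕ →₀ T) :=
  LinearEquiv.ofLinearMap (swindleMap r c) (swindleInv r c)
    (by
      refine LinearMap.ext fun x => Finsupp.ext fun n => ?_
      rcases n with _ | n <;>
        simp [swindleMap_zero, swindleMap_succ, swindleInv_fst, swindleInv_snd, h])
    (by
      refine LinearMap.ext fun x => Prod.ext ?_ (Finsupp.ext fun n => ?_)
      · simp [swindleMap_zero, swindleInv_fst, h]
      · rcases n with _ | n <;>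
          simp [swindleMap_zero, swindleMap_succ, swindleInv_snd, h])

theorem swindle_pairing {β : S →ₗ[k] S' →ₗ[k] V} {γ : T →ₗ[k] T' →ₗ[k] V}
    (h : PairingRetract β γ) :
    PairingEquiv (sumPairing β (powPairing ℕ γ)) (powPairing ℕ γ) := by
  obtain ⟨r, r', c, c', h1, h2, h3, h4⟩ := h
  refine ⟨swindle r c h3, (swindle c' r' h4).symm, fun x y => ?_⟩
  change powPairing ℕ γ (swindleMap r c x) y = sumPairing β (powPairing ℕ γ) x (swindleInv c' r' y)
  induction y using Finsupp.induction_linear with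
  | zero => simp
  | add y z hy hz => simp only [map_add, hy, hz]
  | single m t' =>
    rcases m with _ | m
    · have e : swindleInv c' r' (Finsupp.single 0 t') =
          (r' t', Finsupp.single 0 (t' - c' (r' t'))) := by
        refine Prod.ext ?_ (Finsupp.ext fun n => ?_)
        · simp [swindleInv_fst]
        · rcases n with _ | n <;> simp [swindleInv_snd]
      simp [e, powPairing_single_right, swindleMap_zero, h1, h2]
    · have e : swindleInv c' r' (Finsupp.single (m + 1) t') =
          (0, Finsupp.single (m + 1) (t' - c' (r' t')) + Finsupp.single m (c' (r' t'))) := by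
        refine Prod.ext ?_ (Finsupp.ext fun n => ?_)
        · simp [swindleInv_fst]
        · by_cases hn : n = m + 1
          · subst hn
            simp [swindleInv_snd]
          · by_cases hm : n = m
            · subst hm
              simp [swindleInv_snd]
            · simp [swindleInv_snd, hn, hm]
      simp [e, powPairing_single_right, swindleMap_succ, h1, h2]

theorem sumPairing_comm (β : S →ₗ[k] S' →ₗ[k] V) (γ : T →ₗ[k] T' →ₗ[k] V) :
    PairingEquiv (sumPairing β γ) (sumPairing γ β) :=
  ⟨LinearEquiv.prodComm k S T, LinearEquiv.prodComm k T' S', fun s t' => by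
    simp [add_comm]⟩

theorem PairingEquiv.sum_right {γ : T →ₗ[k] T' →ₗ[k] V} {ε : U →ₗ[k] U' →ₗ[k] V}
    (β : S →ₗ[k] S' →ₗ[k] V) (h : PairingEquiv γ ε) :
    PairingEquiv (sumPairing β γ) (sumPairing β ε) := by
  obtain ⟨R, L, h⟩ := h
  exact ⟨(LinearEquiv.refl k S).prodCongr R, (LinearEquiv.refl k S').prodCongr L, fun s t' => by
    simp [h]⟩

theorem PairingRetract.absorb {X : Type*} [Infinite X] {β : S →ₗ[k] S' →ₗ[k] V}
    {γ : T →ₗ[k] T' →ₗ[k] V} (h : PairingRetract β (powPairing X γ)) :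
    PairingEquiv (sumPairing (powPairing X β) (powPairing X γ)) (powPairing X γ) := by
  obtain ⟨e⟩ : Nonempty (X × X ≃ X) := Cardinal.eq.1 (by simp)
  obtain ⟨e'⟩ : Nonempty (ℕ × X ≃ X) := by
    refine Cardinal.lift_mk_eq'.1 ?_
    simp [Cardinal.aleph0_mul_eq]
  have h1 : PairingRetract (powPairing X β) (powPairing X γ) :=
    (h.pow X).trans ((powPairing_powPairing γ).trans (powPairing_reindex e γ)).retract
  have h2 : PairingEquiv (powPairing ℕ (powPairing X γ)) (powPairing X γ) :=
    (powPairing_powPairing γ).trans (powPairing_reindex e' γ)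
  exact ((h2.symm.sum_right _).trans (swindle_pairing h1)).trans h2

theorem pairingEquiv_of_retracts {X : Type*} [Infinite X] {β : S →ₗ[k] S' →ₗ[k] V}
    {γ : T →ₗ[k] T' →ₗ[k] V} (h : PairingRetract β (powPairing X γ))
    (h' : PairingRetract γ (powPairing X β)) :
    PairingEquiv (powPairing X β) (powPairing X γ) :=
  h'.absorb.symm.trans ((sumPairing_comm _ _).trans h.absorb)

end Pairings

/-! ### Local units and frames -/

section LocalUnits

variable {k B : Type*} [CommRing k] [NonUnitalRing B] [Module k B]

/-- The family `e` consists of idempotents of `D` such that every `x ∈ D` is the sum of the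
`x * e i`, and of the `e i * x`, of which only finitely many are non-zero. -/
structure IsLocalUnitFamily {ι : Type*} (D : Submodule k B) (e : ι → B) : Prop where
  mem : ∀ i, e i ∈ D
  idem : ∀ i, e i * e i = e i
  right : ∀ x ∈ D, ∃ F : Finset ι, ∑ i ∈ F, x * e i = x ∧ ∀ i ∉ F, x * e i = 0
  left : ∀ x ∈ D, ∃ F : Finset ι, ∑ i ∈ F, e i * x = x ∧ ∀ i ∉ F, e i * x = 0

/-- Every finite subset of `D` has a common two-sided unit in `D`. -/
def HasCommonUnits (D : Submodule k B) : Prop :=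
  ∀ s : Finset B, ↑s ⊆ (D : Set B) → ∃ e ∈ D, ∀ x ∈ s, e * x = x ∧ x * e = x

theorem IsLocalUnitFamily.hasCommonUnits {ι : Type*} {D : Submodule k B} {e : ι → B}
    (h : IsLocalUnitFamily D e) : HasCommonUnits D := by
  classical
  intro s hs
  choose! F hF hF₀ using h.right
  choose! F' hF' hF₀' using h.left
  have hsub {x : B} (hx : x ∈ s) : F x ∪ F' x ⊆ s.biUnion fun x => F x ∪ F' x :=
    Finset.subset_biUnion_of_mem (fun x => F x ∪ F' x) hx
  refine ⟨∑ i ∈ s.biUnion fun x => F x ∪ F' x, e i, D.sum_mem fun i _ => h.mem i,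
    fun x hx => ⟨?_, ?_⟩⟩
  · rw [Finset.sum_mul, ← Finset.sum_subset (Finset.subset_union_right.trans (hsub hx)),
      hF' x (hs hx)]
    exact fun i _ hi => hF₀' x (hs hx) i hi
  · rw [Finset.mul_sum, ← Finset.sum_subset (Finset.subset_union_left.trans (hsub hx)),
      hF x (hs hx)]
    exact fun i _ hi => hF₀ x (hs hx) i hi

theorem HasCommonUnits.exists_unit {D : Submodule k B} (h : HasCommonUnits D) {x : B} (hx : x ∈ D) :
    ∃ e ∈ D, e * x = x ∧ x * e = x := by
  simpa using h {x} (by simpa using hx)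

theorem exists_finset_of_mem_iSup_range {ι V : Type*} [AddCommGroup V] [Module k V]
    {f : ι → V →ₗ[k] V} (idem : ∀ i x, f i (f i x) = f i x)
    (orthogonal : ∀ i j, i ≠ j → ∀ x, f j (f i x) = 0) {x : V}
    (hx : x ∈ ⨆ i, LinearMap.range (f i)) :
    ∃ F : Finset ι, ∑ i ∈ F, f i x = x ∧ ∀ i ∉ F, f i x = 0 := by
  classical
  obtain ⟨y, hy, hyx⟩ := (Submodule.mem_iSup_iff_exists_finsupp _ x).1 hx
  rw [Finsupp.sum] at hyx
  have hfy (i j : ι) : f j (y i) = if i = j then y j else 0 := by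
    obtain ⟨z, hz⟩ := hy i
    split_ifs with h
    · subst h
      rw [← hz, idem]
    · rw [← hz, orthogonal i j h]
  have hfx (j : ι) : f j x = y j := by
    rw [← hyx, map_sum]
    simp +contextual [hfy, eq_comm]
  refine ⟨y.support, ?_, fun i hi => ?_⟩
  · simpa only [hfx] using hyx
  · rw [hfx, Finsupp.notMem_support_iff.1 hi]

variable [IsScalarTower k B B] [SMulCommClass k B B]

theorem HasOrthogonalLocalUnits.exists_isLocalUnitFamily {D : NonUnitalSubalgebra k B}
    (h : HasOrthogonalLocalUnits k D) :
    ∃ E : Set D, IsLocalUnitFamily D.toSubmodule fun e : E => (e : B) := by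
  obtain ⟨E, idem, orthogonal, hright, hleft⟩ := h
  have hright := @DirectSum.IsInternal.submodule_iSup_eq_top _ _ _ (_) _ _ _ _ hright
  have hleft := @DirectSum.IsInternal.submodule_iSup_eq_top _ _ _ (_) _ _ _ _ hleft
  have orthogonal (e f : E) (h : e ≠ f) : (e * f : D) = 0 :=
    orthogonal e e.2 f f.2 (Subtype.coe_ne_coe.2 h)
  refine ⟨E, fun e => e.1.2, fun e => congrArg Subtype.val (idem e e.2), fun x hx => ?_,
    fun x hx => ?_⟩
  · obtain ⟨F, hF, hF₀⟩ := exists_finset_of_mem_iSup_range (x := (⟨x, hx⟩ : D))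
      (f := fun e : E => LinearMap.mulRight k (e : D))
      (fun e y => by simp [mul_assoc, idem e.1 e.2])
      (fun e f hef y => by simp [mul_assoc, orthogonal e f hef]) (hright ▸ Submodule.mem_top)
    exact ⟨F, by simpa using congrArg Subtype.val hF,
      fun e he => congrArg Subtype.val (hF₀ e he)⟩
  · obtain ⟨F, hF, hF₀⟩ := exists_finset_of_mem_iSup_range (x := (⟨x, hx⟩ : D))
      (f := fun e : E => LinearMap.mulLeft k (e : D))
      (fun e y => by simp [← mul_assoc, idem e.1 e.2])
      (fun e f hef y => by simp [← mul_assoc, orthogonal f e hef.symm])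
      (hleft ▸ Submodule.mem_top)
    exact ⟨F, by simpa using congrArg Subtype.val hF,
      fun e he => congrArg Subtype.val (hF₀ e he)⟩

theorem exists_sum_of_mem_spanMul {M N : Submodule k B} {x : B} (hx : x ∈ M ⊙ N) :
    ∃ (n : ℕ) (a b : Fin n → B), (∀ i, a i ∈ M) ∧ (∀ i, b i ∈ N) ∧ ∑ i, a i * b i = x := by
  rw [spanMul, Submodule.map₂_eq_span_image2, Submodule.mem_span_set'] at hx
  obtain ⟨n, t, y, rfl⟩ := hx
  choose a ha b hb hab using fun i => (y i).2
  refine ⟨n, fun i => t i • a i, b, fun i => M.smul_mem _ (ha i), hb, ?_⟩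
  simp only [← hab, smul_mul_assoc, LinearMap.mul_apply']

theorem HasCommonUnits.exists_right_unit {S D : Submodule k B} (h : HasCommonUnits D) {x : B}
    (hx : x ∈ S ⊙ D) : ∃ e ∈ D, x * e = x := by
  classical
  obtain ⟨n, a, b, -, hb, rfl⟩ := exists_sum_of_mem_spanMul hx
  obtain ⟨e, he, hbe⟩ := h (Finset.univ.image b) (by simpa [Set.range_subset_iff] using hb)
  refine ⟨e, he, ?_⟩
  rw [Finset.sum_mul]
  exact Finset.sum_congr rfl fun i _ => by rw [mul_assoc, (hbe (b i) (by simp)).2]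

theorem HasCommonUnits.exists_left_unit {S D : Submodule k B} (h : HasCommonUnits D) {x : B}
    (hx : x ∈ D ⊙ S) : ∃ e ∈ D, e * x = x := by
  classical
  obtain ⟨n, a, b, ha, -, rfl⟩ := exists_sum_of_mem_spanMul hx
  obtain ⟨e, he, hea⟩ := h (Finset.univ.image a) (by simpa [Set.range_subset_iff] using ha)
  refine ⟨e, he, ?_⟩
  rw [Finset.mul_sum]
  exact Finset.sum_congr rfl fun i _ => by rw [← mul_assoc, (hea (a i) (by simp)).1]

end LocalUnits

section Frames

variable {k B : Type*} [CommRing k] [NonUnitalRing B] [Module k B] [IsScalarTower k B B]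
  [SMulCommClass k B B]

/-- Families `r` in `M` and `c` in `N`, locally finite on `D`, such that `∑ r j * c j` acts as a
unit on `D`. -/
structure IsFrame {X : Type*} (D M N : Submodule k B) (r c : X → B) : Prop where
  mem_left : ∀ j, r j ∈ M
  mem_right : ∀ j, c j ∈ N
  right : ∀ d ∈ D, ∃ F : Finset X, (∀ j ∉ F, d * r j = 0) ∧ ∑ j ∈ F, d * r j * c j = d
  left : ∀ d ∈ D, ∃ F : Finset X, (∀ j ∉ F, c j * d = 0) ∧ ∑ j ∈ F, r j * (c j * d) = d

theorem IsLocalUnitFamily.exists_isFrame {ι : Type*} {D M N : Submodule k B} {e : ι → B}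
    (h : IsLocalUnitFamily D e) (hD : D = M ⊙ N) (hM : D ⊙ M ≤ M) (hN : N ⊙ D ≤ N) :
    ∃ (n : ι → ℕ) (r c : (Σ i, Fin (n i)) → B), IsFrame D M N r c := by
  choose n a b ha hb hab using fun i => exists_sum_of_mem_spanMul (hD ▸ h.mem i)
  have hsum (i : ι) : ∑ l, e i * a i l * (b i l * e i) = e i := by
    calc _ = e i * (∑ l, a i l * b i l) * e i := by
          simp only [Finset.mul_sum, Finset.sum_mul, mul_assoc]
      _ = e i := by rw [hab, h.idem, h.idem]
  refine ⟨n, fun j => e j.1 * a j.1 j.2, fun j => b j.1 j.2 * e j.1,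
    fun j => hM (mul_mem_spanMul (h.mem _) (ha _ _)),
    fun j => hN (mul_mem_spanMul (hb _ _) (h.mem _)), fun d hd => ?_, fun d hd => ?_⟩
  · obtain ⟨F, hF, hF₀⟩ := h.right d hd
    refine ⟨F.sigma fun _ => Finset.univ, fun j hj => ?_, ?_⟩
    · rw [← mul_assoc, hF₀ _ (by simpa using hj), zero_mul]
    · simp only [Finset.sum_sigma, mul_assoc d, ← Finset.mul_sum, hsum]
      rw [Finset.mul_sum, hF]
  · obtain ⟨F, hF, hF₀⟩ := h.left d hd
    refine ⟨F.sigma fun _ => Finset.univ, fun j hj => ?_, ?_⟩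
    · rw [mul_assoc, hF₀ _ (by simpa using hj), mul_zero]
    · simp only [Finset.sum_sigma, ← mul_assoc _ _ d, ← Finset.sum_mul, hsum]
      rw [Finset.sum_mul, hF]

/-- The product of `B` as a pairing of two submodules. -/
def mulPairing (S S' : Submodule k B) : S →ₗ[k] S' →ₗ[k] B :=
  (LinearMap.mul k B).domRestrict₁₂ S S'

@[simp]
theorem mulPairing_apply (S S' : Submodule k B) (s : S) (s' : S') :
    mulPairing S S' s s' = s * s' := rfl

theorem IsFrame.pairingRetract {X : Type*} {D M N S S' T T' : Submodule k B} {r c : X → B}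
    (h : IsFrame D M N r c) (hS : ∀ s ∈ S, ∃ d ∈ D, s * d = s)
    (hS' : ∀ s ∈ S', ∃ d ∈ D, d * s = s) (hSM : S ⊙ M ≤ T) (hTN : T ⊙ N ≤ S)
    (hNS : N ⊙ S' ≤ T') (hMT : M ⊙ T' ≤ S') :
    PairingRetract (mulPairing S S') (powPairing X (mulPairing T T')) := by
  refine .of_locallyFinite
    (fun j => (LinearMap.mulRight k (r j)).restrict fun s hs =>
      hSM (mul_mem_spanMul hs (h.mem_left j)))
    (fun j => (LinearMap.mulLeft k (r j)).restrict fun t ht =>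
      hMT (mul_mem_spanMul (h.mem_left j) ht))
    (fun j => (LinearMap.mulRight k (c j)).restrict fun t ht =>
      hTN (mul_mem_spanMul ht (h.mem_right j)))
    (fun j => (LinearMap.mulLeft k (c j)).restrict fun s hs =>
      hNS (mul_mem_spanMul (h.mem_right j) hs))
    (fun j s t => by simp [mul_assoc]) (fun j t s => by simp [mul_assoc]) ?_ ?_
  · rintro ⟨s, hs⟩
    obtain ⟨d, hd, hsd⟩ := hS s hs
    obtain ⟨F, hF₀, hF⟩ := h.right d hd
    refine ⟨F, fun j hj => Subtype.ext ?_, Subtype.ext ?_⟩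
    · change s * r j = 0
      rw [← hsd, mul_assoc, hF₀ j hj, mul_zero]
    · calc _ = s * ∑ j ∈ F, d * r j * c j := by
            simp [Finset.mul_sum, ← mul_assoc, hsd]
        _ = s := by rw [hF, hsd]
  · rintro ⟨s, hs⟩
    obtain ⟨d, hd, hds⟩ := hS' s hs
    obtain ⟨F, hF₀, hF⟩ := h.left d hd
    refine ⟨F, fun j hj => Subtype.ext ?_, Subtype.ext ?_⟩
    · change c j * s = 0
      rw [← hds, ← mul_assoc, hF₀ j hj, zero_mul]
    · calc _ = (∑ j ∈ F, r j * (c j * d)) * s := by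
            simp [Finset.sum_mul, mul_assoc, hds]
        _ = s := by rw [hF, hds]

/-- The injection `(i, l) ↦ (i, l)`. -/
def sigmaFinEmbedding {ι : Type*} (n : ι → ℕ) : (Σ i, Fin (n i)) ↪ ι × ℕ :=
  ((Function.Embedding.refl ι).sigmaMap fun _ => Fin.valEmbedding).trans
    (Equiv.sigmaEquivProd ι ℕ).toEmbedding

/-- The standing assumptions of a (non-unital) Morita context with modules `M` and `N`: the
algebras `M ⊙ N` and `N ⊙ M` have local units and act non-degenerately on `M` and `N`. -/
structure IsUnitalContext (M N : Submodule k B) : Prop where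
  units_left : HasCommonUnits (M ⊙ N)
  units_right : HasCommonUnits (N ⊙ M)
  mul_left : M ⊙ N ⊙ M = M
  mul_right : N ⊙ M ⊙ N = N

theorem IsUnitalContext.pairingEquiv {X ι ι' : Type*} [Infinite X] {M N : Submodule k B}
    {e : ι → B} {e' : ι' → B} (h : IsUnitalContext M N) (he : IsLocalUnitFamily (M ⊙ N) e)
    (he' : IsLocalUnitFamily (N ⊙ M) e') (f : ι × ℕ ↪ X) (f' : ι' × ℕ ↪ X) :
    PairingEquiv (powPairing X (mulPairing (M ⊙ N) (M ⊙ N))) (powPairing X (mulPairing M N)) := by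
  have hM : M ⊙ (N ⊙ M) = M := by rw [← spanMul_assoc, h.mul_left]
  have hN : N ⊙ (M ⊙ N) = N := by rw [← spanMul_assoc, h.mul_right]
  obtain ⟨n, r, c, hrc⟩ := he.exists_isFrame rfl h.mul_left.le hN.le
  obtain ⟨n', r', c', hrc'⟩ := he'.exists_isFrame rfl h.mul_right.le hM.le
  have hD : ∀ s ∈ M ⊙ N, ∃ d ∈ M ⊙ N, d * s = s ∧ s * d = s := fun s => h.units_left.exists_unit
  have h₁ := hrc.pairingRetract (S := M ⊙ N) (S' := M ⊙ N)
    (fun s hs => (hD s hs).imp fun _ hd => ⟨hd.1, hd.2.2⟩)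
    (fun s hs => (hD s hs).imp fun _ hd => ⟨hd.1, hd.2.1⟩) h.mul_left.le le_rfl hN.le le_rfl
  have h₂ := hrc'.pairingRetract (S := M) (S' := N)
    (fun s hs => h.units_right.exists_right_unit (hM.symm ▸ hs))
    (fun s hs => h.units_right.exists_left_unit (h.mul_right.symm ▸ hs))
    le_rfl h.mul_left.le le_rfl hN.le
  exact pairingEquiv_of_retracts
    (h₁.trans (powPairing_retract_of_embedding ((sigmaFinEmbedding n).trans f) _))
    (h₂.trans (powPairing_retract_of_embedding ((sigmaFinEmbedding n').trans f') _))

end Frames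

theorem exists_linearEquiv_of_injOn {k V U : Type*} [CommRing k] [AddCommGroup V] [Module k V]
    [AddCommGroup U] [Module k U] {S T : Submodule k V} {F G : V →ₗ[k] U} (hF : Set.InjOn F S)
    (hG : Set.InjOn G T) (hST : S.map F = T.map G) : ∃ e : S ≃ₗ[k] T, ∀ s, G (e s) = F s := by
  have hF' : Function.Injective (F.domRestrict S) := (Set.injOn_iff_injective.1 hF :)
  have hG' : Function.Injective (G.domRestrict T) := (Set.injOn_iff_injective.1 hG :)
  let e₁ := LinearEquiv.ofInjective _ hF'
  let e₂ := LinearEquiv.ofInjective _ hG'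
  have hrange : LinearMap.range (F.domRestrict S) = LinearMap.range (G.domRestrict T) := by
    rw [LinearMap.range_domRestrict, LinearMap.range_domRestrict, hST]
  let e := e₁.trans ((LinearEquiv.ofEq _ _ hrange).trans e₂.symm)
  exact ⟨e, fun s => congrArg Subtype.val (e₂.apply_symm_apply _)⟩

section

variable {k C : Type*} [CommRing k] [NonUnitalRing C] [Module k C] [IsScalarTower k C C]
  [SMulCommClass k C C] {S : Submodule k C} {c : C}

theorem mul_mem_top_spanMul (a : C) (hc : c ∈ ⊤ ⊙ S) : a * c ∈ ⊤ ⊙ S := by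
  have := mul_mem_spanMul (Submodule.mem_top (x := a)) hc
  rw [← spanMul_assoc] at this
  exact spanMul_mono le_top le_rfl this

theorem mul_mem_spanMul_top (hc : c ∈ S ⊙ ⊤) (a : C) : c * a ∈ S ⊙ ⊤ := by
  have := mul_mem_spanMul hc (Submodule.mem_top (x := a))
  rw [spanMul_assoc] at this
  exact spanMul_mono le_rfl le_top this

end

namespace IsUnitalContext

variable {k C : Type*} [CommRing k] [NonUnitalRing C] [Module k C] [IsScalarTower k C C]
  [SMulCommClass k C C] {M N S : Submodule k C} (h : IsUnitalContext M N)
include h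

theorem symm : IsUnitalContext N M :=
  ⟨h.units_right, h.units_left, h.mul_right, h.mul_left⟩

theorem exists_right_unit {c : C} (hc : c ∈ S ⊙ N) : ∃ e ∈ M ⊙ N, c * e = c := by
  rw [← h.mul_right, spanMul_assoc, ← spanMul_assoc] at hc
  exact h.units_left.exists_right_unit hc

theorem exists_left_unit {c : C} (hc : c ∈ M ⊙ S) : ∃ e ∈ M ⊙ N, e * c = c := by
  rw [← h.mul_left, spanMul_assoc] at hc
  exact h.units_left.exists_left_unit hc

theorem le_mul_top : N ≤ N ⊙ ⊤ := by
  conv_lhs => rw [← h.mul_right, spanMul_assoc]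
  exact spanMul_mono le_rfl le_top

theorem le_top_mul : N ≤ ⊤ ⊙ N :=
  h.mul_right.ge.trans (spanMul_mono le_top le_rfl)

theorem eq_zero_of_mul_right {c : C} (hc : c ∈ S ⊙ N) (hM : ∀ m ∈ M, c * m = 0) : c = 0 := by
  obtain ⟨e, he, hce⟩ := h.exists_right_unit hc
  have : M ⊙ N ≤ LinearMap.ker (LinearMap.mulLeft k c) :=
    spanMul_le.2 fun m hm n _ => by simp [← mul_assoc, hM m hm]
  rw [← hce]
  exact this he

theorem eq_zero_of_mul_left {c : C} (hc : c ∈ M ⊙ S) (hN : ∀ n ∈ N, n * c = 0) : c = 0 := by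
  obtain ⟨e, he, hec⟩ := h.exists_left_unit hc
  have : M ⊙ N ≤ LinearMap.ker (LinearMap.mulRight k c) :=
    spanMul_le.2 fun m _ n hn => by simp [mul_assoc, hN n hn]
  rw [← hec]
  exact this he

end IsUnitalContext

/-! ### Invertible multipliers of Morita contexts -/

section InvertibleMultiplier

variable {k C : Type*} [CommRing k] [NonUnitalRing C] [Module k C] [IsScalarTower k C C]
  [SMulCommClass k C C]

/-- A formal invertible element `u` with `M = (M ⊙ N) u` and `N = u⁻¹ (M ⊙ N)`: `right` is
`c ↦ c u`, defined on `C ⊙ N`, and `left` is `b ↦ u b`, defined on `N ⊙ C`. -/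
structure InvertibleMultiplier (M N : Submodule k C) where
  context : IsUnitalContext M N
  right : ↥(⊤ ⊙ N) ≃ₗ[k] ↥(⊤ ⊙ M)
  left : ↥(N ⊙ ⊤) ≃ₗ[k] ↥(M ⊙ ⊤)
  right_mul_eq_mul_left : ∀ a b, (right a : C) * b = a * left b
  right_mem : ∀ a : ↥((⊤ : Submodule k C) ⊙ N), (a : C) ∈ M ⊙ N → (right a : C) ∈ M
  right_symm_mem : ∀ a : ↥((⊤ : Submodule k C) ⊙ M), (a : C) ∈ N ⊙ M → (right.symm a : C) ∈ N

namespace InvertibleMultiplier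

variable {M N P Q S : Submodule k C}

/-- The inverse `u⁻¹`. -/
def symm (u : InvertibleMultiplier M N) : InvertibleMultiplier N M where
  context := u.context.symm
  right := u.right.symm
  left := u.left.symm
  right_mul_eq_mul_left a b := by
    simpa using (u.right_mul_eq_mul_left (u.right.symm a) (u.left.symm b)).symm
  right_mem := u.right_symm_mem
  right_symm_mem := u.right_mem

/-- The multiplier `u = 1`, for a context with `M = N`. -/
def ofEq (h : IsUnitalContext M N) (hMN : M = N) (hM : M ⊙ M ≤ M) :
    InvertibleMultiplier M N where
  context := h
  right := LinearEquiv.ofEq _ _ (by rw [hMN])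
  left := LinearEquiv.ofEq _ _ (by rw [hMN])
  right_mul_eq_mul_left _ _ := rfl
  right_mem a ha := hM (by simpa [← hMN] using ha)
  right_symm_mem a ha := hMN ▸ hM (by simpa [← hMN] using ha)

/-- The map `c ↦ c u` as a function on `C`, with junk value `0` outside of `C ⊙ N`. -/
def rightMul (u : InvertibleMultiplier M N) : C → C :=
  Function.extend Subtype.val (fun c => (u.right c : C)) 0

/-- The map `b ↦ u b` as a function on `C`, with junk value `0` outside of `N ⊙ C`. -/
def leftMul (u : InvertibleMultiplier M N) : C → C :=
  Function.extend Subtype.val (fun b => (u.left b : C)) 0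

variable (u : InvertibleMultiplier M N) {a b c : C}

theorem rightMul_of_mem (hc : c ∈ ⊤ ⊙ N) : u.rightMul c = u.right ⟨c, hc⟩ :=
  Subtype.val_injective.extend_apply _ _ ⟨c, hc⟩

theorem leftMul_of_mem (hb : b ∈ N ⊙ ⊤) : u.leftMul b = u.left ⟨b, hb⟩ :=
  Subtype.val_injective.extend_apply _ _ ⟨b, hb⟩

theorem rightMul_mem_top (hc : c ∈ ⊤ ⊙ N) : u.rightMul c ∈ ⊤ ⊙ M :=
  u.rightMul_of_mem hc ▸ (u.right ⟨c, hc⟩).2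

theorem leftMul_mem_top (hb : b ∈ N ⊙ ⊤) : u.leftMul b ∈ M ⊙ ⊤ :=
  u.leftMul_of_mem hb ▸ (u.left ⟨b, hb⟩).2

theorem rightMul_add (ha : a ∈ ⊤ ⊙ N) (hc : c ∈ ⊤ ⊙ N) :
    u.rightMul (a + c) = u.rightMul a + u.rightMul c := by
  rw [u.rightMul_of_mem ha, u.rightMul_of_mem hc, u.rightMul_of_mem (add_mem ha hc)]
  exact congrArg Subtype.val (map_add u.right ⟨a, ha⟩ ⟨c, hc⟩)

theorem leftMul_add (ha : a ∈ N ⊙ ⊤) (hb : b ∈ N ⊙ ⊤) :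
    u.leftMul (a + b) = u.leftMul a + u.leftMul b := by
  rw [u.leftMul_of_mem ha, u.leftMul_of_mem hb, u.leftMul_of_mem (add_mem ha hb)]
  exact congrArg Subtype.val (map_add u.left ⟨a, ha⟩ ⟨b, hb⟩)

theorem rightMul_smul (t : k) (hc : c ∈ ⊤ ⊙ N) : u.rightMul (t • c) = t • u.rightMul c := by
  rw [u.rightMul_of_mem hc, u.rightMul_of_mem (Submodule.smul_mem _ t hc)]
  exact congrArg Subtype.val (map_smul u.right t ⟨c, hc⟩)

theorem leftMul_smul (t : k) (hb : b ∈ N ⊙ ⊤) : u.leftMul (t • b) = t • u.leftMul b := by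
  rw [u.leftMul_of_mem hb, u.leftMul_of_mem (Submodule.smul_mem _ t hb)]
  exact congrArg Subtype.val (map_smul u.left t ⟨b, hb⟩)

theorem symm_rightMul_rightMul (hc : c ∈ ⊤ ⊙ N) : u.symm.rightMul (u.rightMul c) = c := by
  rw [u.rightMul_of_mem hc, u.symm.rightMul_of_mem (u.right ⟨c, hc⟩).2]
  exact congrArg Subtype.val (u.right.symm_apply_apply ⟨c, hc⟩)

theorem symm_leftMul_leftMul (hb : b ∈ N ⊙ ⊤) : u.symm.leftMul (u.leftMul b) = b := by
  rw [u.leftMul_of_mem hb, u.symm.leftMul_of_mem (u.left ⟨b, hb⟩).2]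
  exact congrArg Subtype.val (u.left.symm_apply_apply ⟨b, hb⟩)

theorem rightMul_mul (ha : a ∈ ⊤ ⊙ N) (hb : b ∈ N ⊙ ⊤) :
    u.rightMul a * b = a * u.leftMul b := by
  rw [u.rightMul_of_mem ha, u.leftMul_of_mem hb]
  exact u.right_mul_eq_mul_left ⟨a, ha⟩ ⟨b, hb⟩

theorem rightMul_mul_left (a : C) (hc : c ∈ ⊤ ⊙ N) :
    u.rightMul (a * c) = a * u.rightMul c := by
  have hac := mul_mem_top_spanMul a hc
  rw [← sub_eq_zero]
  refine u.context.symm.eq_zero_of_mul_right (S := ⊤) (sub_mem (u.rightMul_mem_top hac)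
    (mul_mem_top_spanMul a (u.rightMul_mem_top hc))) fun n hn => ?_
  have hn := u.context.le_mul_top hn
  rw [sub_mul, u.rightMul_mul hac hn, mul_assoc, mul_assoc, u.rightMul_mul hc hn, sub_self]

theorem leftMul_mul_right (hb : b ∈ N ⊙ ⊤) (a : C) :
    u.leftMul (b * a) = u.leftMul b * a := by
  have hba := mul_mem_spanMul_top hb a
  rw [← sub_eq_zero]
  refine u.context.eq_zero_of_mul_left (S := ⊤) (sub_mem (u.leftMul_mem_top hba)
    (mul_mem_spanMul_top (u.leftMul_mem_top hb) a)) fun n hn => ?_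
  have hn := u.context.le_top_mul hn
  rw [mul_sub, ← mul_assoc, ← u.rightMul_mul hn hba, ← u.rightMul_mul hn hb, mul_assoc, sub_self]

theorem rightMul_mem (hc : c ∈ ⊤ ⊙ N) (hS : c ∈ S) : u.rightMul c ∈ S ⊙ M := by
  obtain ⟨e, he, hce⟩ := u.context.exists_right_unit hc
  have he' : e ∈ ⊤ ⊙ N := spanMul_mono le_top le_rfl he
  rw [← hce, u.rightMul_mul_left c he']
  exact mul_mem_spanMul hS (u.rightMul_of_mem he' ▸ u.right_mem _ he)

theorem leftMul_mem (hb : b ∈ N ⊙ ⊤) (hS : b ∈ S) : u.leftMul b ∈ M ⊙ S := by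
  obtain ⟨e, he, heb⟩ := u.context.exists_left_unit (u.leftMul_mem_top hb)
  have he' : e ∈ ⊤ ⊙ N := spanMul_mono le_top le_rfl he
  rw [← heb, ← u.rightMul_mul he' hb]
  exact mul_mem_spanMul (u.rightMul_of_mem he' ▸ u.right_mem _ he) hS

theorem leftMul_rightMul (v : InvertibleMultiplier P Q) (hN : c ∈ N ⊙ ⊤) (hQ : c ∈ ⊤ ⊙ Q) :
    u.leftMul (v.rightMul c) = v.rightMul (u.leftMul c) := by
  obtain ⟨e, he, hec⟩ := u.context.symm.exists_left_unit hN
  have he' : e ∈ N ⊙ ⊤ := spanMul_mono le_rfl le_top he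
  calc _ = u.leftMul (e * v.rightMul c) := by rw [← v.rightMul_mul_left e hQ, hec]
    _ = v.rightMul (u.leftMul e * c) := by
      rw [u.leftMul_mul_right he', v.rightMul_mul_left _ hQ]
    _ = _ := by rw [← u.leftMul_mul_right he', hec]

end InvertibleMultiplier

namespace IsUnitalContext

variable {M N : Submodule k C} (h : IsUnitalContext M N)
  {ρ : ↥(M ⊙ N) ≃ₗ[k] M} {σ : ↥(M ⊙ N) ≃ₗ[k] N} (hρσ : ∀ x y, (ρ x : C) * σ y = x * y)
include h hρσ

theorem exists_right : ∃ r : ↥((⊤ : Submodule k C) ⊙ N) ≃ₗ[k] ↥((⊤ : Submodule k C) ⊙ M),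
    ∀ a y, (r a : C) * σ y = a * y := by
  let F : C →ₗ[k] (↥(M ⊙ N) → C) := LinearMap.pi fun y => LinearMap.mulRight k (y : C)
  let G : C →ₗ[k] (↥(M ⊙ N) → C) := LinearMap.pi fun y => LinearMap.mulRight k (σ y : C)
  have hF : Set.InjOn F ↑(⊤ ⊙ N) := by
    refine LinearMap.injOn_of_disjoint_ker le_rfl (Submodule.disjoint_def.2 fun c hc hFc => ?_)
    obtain ⟨y, hy, hcy⟩ := h.exists_right_unit hc
    rw [← hcy]
    exact congrFun hFc ⟨y, hy⟩
  have hG : Set.InjOn G ↑(⊤ ⊙ M) := by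
    refine LinearMap.injOn_of_disjoint_ker le_rfl (Submodule.disjoint_def.2 fun c hc hGc => ?_)
    exact h.symm.eq_zero_of_mul_right hc fun n hn => by
      simpa [G] using congrFun hGc (σ.symm ⟨n, hn⟩)
  have hFG : (⊤ ⊙ N).map F = (⊤ ⊙ M).map G := by
    apply le_antisymm
    · rintro _ ⟨c, hc, rfl⟩
      obtain ⟨e, he, hce⟩ := h.exists_right_unit hc
      refine ⟨c * ρ ⟨e, he⟩, mul_mem_spanMul Submodule.mem_top (ρ ⟨e, he⟩).2, funext fun y => ?_⟩
      simp [F, G, mul_assoc, hρσ, ← mul_assoc c e, hce]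
    · refine Submodule.map_le_iff_le_comap.2 (spanMul_le.2 fun a _ m hm => ?_)
      obtain ⟨x, hx⟩ := ρ.surjective ⟨m, hm⟩
      obtain rfl : (ρ x : C) = m := congrArg Subtype.val hx
      refine ⟨a * x, mul_mem_top_spanMul a (spanMul_mono le_top le_rfl x.2), funext fun y => ?_⟩
      simp [F, G, mul_assoc, hρσ]
  obtain ⟨r, hr⟩ := exists_linearEquiv_of_injOn hF hG hFG
  exact ⟨r, fun a y => congrFun (hr a) y⟩

theorem exists_left : ∃ l : ↥(N ⊙ (⊤ : Submodule k C)) ≃ₗ[k] ↥(M ⊙ (⊤ : Submodule k C)),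
    ∀ b x, (ρ x : C) * b = x * l b := by
  let F : C →ₗ[k] (↥(M ⊙ N) → C) := LinearMap.pi fun x => LinearMap.mulLeft k (ρ x : C)
  let G : C →ₗ[k] (↥(M ⊙ N) → C) := LinearMap.pi fun x => LinearMap.mulLeft k (x : C)
  have hF : Set.InjOn F ↑(N ⊙ ⊤) := by
    refine LinearMap.injOn_of_disjoint_ker le_rfl (Submodule.disjoint_def.2 fun c hc hFc => ?_)
    exact h.symm.eq_zero_of_mul_left hc fun m hm => by
      simpa [F] using congrFun hFc (ρ.symm ⟨m, hm⟩)
  have hG : Set.InjOn G ↑(M ⊙ ⊤) := by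
    refine LinearMap.injOn_of_disjoint_ker le_rfl (Submodule.disjoint_def.2 fun c hc hGc => ?_)
    obtain ⟨x, hx, hxc⟩ := h.exists_left_unit hc
    rw [← hxc]
    exact congrFun hGc ⟨x, hx⟩
  have hFG : (N ⊙ ⊤).map F = (M ⊙ ⊤).map G := by
    apply le_antisymm
    · refine Submodule.map_le_iff_le_comap.2 (spanMul_le.2 fun n hn a _ => ?_)
      obtain ⟨y, hy⟩ := σ.surjective ⟨n, hn⟩
      obtain rfl : (σ y : C) = n := congrArg Subtype.val hy
      refine ⟨y * a, mul_mem_spanMul_top (spanMul_mono le_rfl le_top y.2) a, funext fun x => ?_⟩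
      simp [F, G, ← mul_assoc, hρσ]
    · rintro _ ⟨c, hc, rfl⟩
      obtain ⟨e, he, hec⟩ := h.exists_left_unit hc
      refine ⟨σ ⟨e, he⟩ * c, mul_mem_spanMul (σ ⟨e, he⟩).2 Submodule.mem_top, funext fun x => ?_⟩
      simp [F, G, ← mul_assoc, hρσ, mul_assoc _ e, hec]
  obtain ⟨l, hl⟩ := exists_linearEquiv_of_injOn hF hG hFG
  exact ⟨l, fun b x => (congrFun (hl b) x).symm⟩

theorem nonempty_invertibleMultiplier : Nonempty (InvertibleMultiplier M N) := by
  obtain ⟨r, hr⟩ := h.exists_right hρσ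
  obtain ⟨l, hl⟩ := h.exists_left hρσ
  have eq_of_mul_σ {a b : C} (ha : a ∈ ⊤ ⊙ M) (hb : b ∈ ⊤ ⊙ M)
      (hab : ∀ y, a * σ y = b * σ y) : a = b :=
    sub_eq_zero.1 <| h.symm.eq_zero_of_mul_right (sub_mem ha hb) fun n hn => by
      simpa [sub_mul, sub_eq_zero] using hab (σ.symm ⟨n, hn⟩)
  have r_eq (a : ↥((⊤ : Submodule k C) ⊙ N)) {e : C} (he : e ∈ M ⊙ N) (hae : a * e = a) :
      (r a : C) = a * ρ ⟨e, he⟩ :=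
    eq_of_mul_σ (r a).2 (mul_mem_spanMul Submodule.mem_top (ρ ⟨e, he⟩).2) fun y => by
      rw [hr, mul_assoc, hρσ, ← mul_assoc, hae]
  refine ⟨⟨h, r, l, fun a b => ?_, fun a ha => ?_, fun a ha => ?_⟩⟩
  · obtain ⟨e, he, hae⟩ := h.exists_right_unit a.2
    rw [r_eq a he hae, mul_assoc, hl, ← mul_assoc, hae]
  · have : (r a : C) = ρ ⟨a, ha⟩ :=
      eq_of_mul_σ (r a).2 (h.symm.le_top_mul (ρ ⟨a, ha⟩).2) fun y => by rw [hr, hρσ]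
    exact this ▸ (ρ ⟨a, ha⟩).2
  · let F : C →ₗ[k] (↥(M ⊙ N) → C) := LinearMap.pi fun y => LinearMap.mulRight k (y : C)
    let G : C →ₗ[k] (↥(M ⊙ N) → C) := LinearMap.pi fun y => LinearMap.mulRight k (σ y : C)
    have hNM : N ⊙ M ≤ (N.map F).comap G := spanMul_le.2 fun n hn m hm => by
      obtain ⟨x, hx⟩ := ρ.surjective ⟨m, hm⟩
      obtain rfl : (ρ x : C) = m := congrArg Subtype.val hx
      refine ⟨n * x, ?_, funext fun y => by simp [F, G, mul_assoc, hρσ]⟩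
      have := mul_mem_spanMul hn x.2
      rwa [← spanMul_assoc, h.mul_right] at this
    obtain ⟨b, hb, hFb⟩ := hNM ha
    have : r ⟨b, h.le_top_mul hb⟩ = a := Subtype.ext <|
      eq_of_mul_σ (r _).2 a.2 fun y => (hr _ y).trans (congrFun hFb y)
    rwa [← this, LinearEquiv.symm_apply_apply]

end IsUnitalContext

end InvertibleMultiplier

/-! ### Finitely supported matrices -/

namespace FMat

section Entries

variable {X k B : Type*} [CommRing k] [NonUnitalRing B] [Module k B]

/-- The finite set of positions of the non-zero entries. -/
def support (a : FMat X B) : Finset (X × X) := Finsupp.support (show X × X →₀ B from a)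

/-- The matrix with entry `b` at `(x, y)` and all other entries zero, as a linear map in `b`. -/
def single (k : Type*) {X B : Type*} [CommRing k] [NonUnitalRing B] [Module k B] (x y : X) :
    B →ₗ[k] FMat X B :=
  (Finsupp.lsingle (x, y) : B →ₗ[k] (X × X →₀ B))

open Classical in
theorem entry_single (x y x' y' : X) (b : B) :
    (single k x y b).entry x' y' = if x = x' ∧ y = y' then b else 0 := by
  change (Finsupp.single (x, y) b : X × X →₀ B) (x', y') = _
  simp [Finsupp.single_apply]

theorem single_mem_component {S : Submodule k B} (x y : X) {b : B} (hb : b ∈ S) :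
    single k x y b ∈ component X S := by
  classical
  intro x' y'
  rw [entry_single]
  split_ifs
  exacts [hb, S.zero_mem]

open Classical in
theorem single_mul_single (x y y' z : X) (a b : B) :
    single k x y a * single k y' z b = if y = y' then single k x z (a * b) else 0 := by
  ext x₀ z₀
  rw [entry_mul_of_subset _ _ _ _ (Finset.subset_insert y _), Finset.sum_eq_single y]
  · by_cases hy : y = y' <;> by_cases hx : x = x₀ <;> by_cases hz : z = z₀ <;>
      simp [entry_single, entry_zero, hx, hy, hz, Ne.symm]
  · intro y₁ _ hy₁
    rw [entry_single, if_neg fun h => hy₁ h.2.symm, zero_mul]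
  · simp

variable (k) in
theorem sum_single (a : FMat X B) :
    ∑ p ∈ a.support, single k p.1 p.2 (a.entry p.1 p.2) = a :=
  Finsupp.sum_single (show X × X →₀ B from a)

theorem component_le {S : Submodule k B} {P : Submodule k (FMat X B)}
    (h : ∀ x y, S ≤ P.comap (single k x y)) : component X S ≤ P := fun a ha => by
  rw [← sum_single k a]
  exact P.sum_mem fun p _ => h p.1 p.2 (ha p.1 p.2)

/-- The diagonal matrix with entry `e` at the positions in `Q`. -/
def diag (k : Type*) {X B : Type*} [CommRing k] [NonUnitalRing B] [Module k B] (Q : Finset X)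
    (e : B) : FMat X B :=
  ∑ x ∈ Q, single k x x e

theorem diag_mul {Q : Finset X} {e : B} {a : FMat X B}
    (h : ∀ p ∈ a.support, p.1 ∈ Q ∧ e * a.entry p.1 p.2 = a.entry p.1 p.2) :
    diag k Q e * a = a := by
  classical
  conv_lhs => rw [← sum_single k a, Finset.mul_sum]
  conv_rhs => rw [← sum_single k a]
  refine Finset.sum_congr rfl fun p hp => ?_
  simp [diag, Finset.sum_mul, single_mul_single, h p hp]

theorem mul_diag {Q : Finset X} {e : B} {a : FMat X B}
    (h : ∀ p ∈ a.support, p.2 ∈ Q ∧ a.entry p.1 p.2 * e = a.entry p.1 p.2) :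
    a * diag k Q e = a := by
  classical
  conv_lhs => rw [← sum_single k a, Finset.sum_mul]
  conv_rhs => rw [← sum_single k a]
  refine Finset.sum_congr rfl fun p hp => ?_
  simp [diag, Finset.mul_sum, single_mul_single, h p hp]

theorem hasCommonUnits_component {D : Submodule k B} (h : HasCommonUnits D) :
    HasCommonUnits (component X D) := by
  classical
  intro s hs
  obtain ⟨e, he, hes⟩ :=
    h (s.biUnion fun a => a.support.image fun p => a.entry p.1 p.2) fun b hb => by
      simp only [Finset.coe_biUnion, Finset.coe_image, Set.mem_iUnion, Set.mem_image] at hb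
      obtain ⟨a, ha, p, -, rfl⟩ := hb
      exact hs ha p.1 p.2
  have hes {a : FMat X B} (ha : a ∈ s) {p : X × X} (hp : p ∈ a.support) :=
    hes _ (Finset.mem_biUnion.2 ⟨a, ha, Finset.mem_image_of_mem _ hp⟩)
  let Q : Finset X := s.biUnion fun a => a.support.image Prod.fst ∪ a.support.image Prod.snd
  have hQ {a : FMat X B} (ha : a ∈ s) {p : X × X} (hp : p ∈ a.support) : p.1 ∈ Q ∧ p.2 ∈ Q :=
    ⟨Finset.mem_biUnion.2 ⟨a, ha, Finset.mem_union_left _ (Finset.mem_image_of_mem _ hp)⟩,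
      Finset.mem_biUnion.2 ⟨a, ha, Finset.mem_union_right _ (Finset.mem_image_of_mem _ hp)⟩⟩
  exact ⟨diag k Q e, Submodule.sum_mem _ fun x _ => single_mem_component x x he, fun a ha =>
    ⟨diag_mul fun p hp => ⟨(hQ ha hp).1, (hes ha hp).1⟩,
      mul_diag fun p hp => ⟨(hQ ha hp).2, (hes ha hp).2⟩⟩⟩

end Entries

section Rows

variable {X k B : Type*} [CommRing k] [NonUnitalRing B] [Module k B]

/-- A matrix with entries in `S`, as a finitely supported function with values in `S`. -/
def entriesEquiv (X : Type*) (S : Submodule k B) : (X × X →₀ S) ≃ₗ[k] component X S :=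
  .ofBijective
    ((Finsupp.mapRange.linearMap S.subtype : (X × X →₀ S) →ₗ[k] (X × X →₀ B)).codRestrict
      (component X S) fun f x y => (f (x, y)).2)
    ⟨fun _ _ h => Finsupp.ext fun p => Subtype.ext
      (congrArg (fun a : component X S => a.1.entry p.1 p.2) h),
    fun a => ⟨Finsupp.onFinset a.1.support (fun p => ⟨a.1.entry p.1 p.2, a.2 p.1 p.2⟩)
      fun _ hp => Finsupp.mem_support_iff.2 fun h => hp (Subtype.ext h),
      Subtype.ext (FMat.ext fun _ _ => rfl)⟩⟩

/-- The matrix with entries in `S` that has the given rows. -/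
def rowsEquiv (X : Type*) (S : Submodule k B) : (X →₀ X →₀ S) ≃ₗ[k] component X S :=
  (Finsupp.curryLinearEquiv k).symm.trans (entriesEquiv X S)

/-- The matrix with entries in `S` that has the given columns. -/
def colsEquiv (X : Type*) (S : Submodule k B) : (X →₀ X →₀ S) ≃ₗ[k] component X S :=
  (Finsupp.curryLinearEquiv k).symm.trans
    ((Finsupp.domLCongr (Equiv.prodComm X X)).trans (entriesEquiv X S))

theorem entry_rowsEquiv (S : Submodule k B) (f : X →₀ X →₀ S) (x y : X) :
    (rowsEquiv X S f : FMat X B).entry x y = f x y := rfl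

theorem entry_colsEquiv (S : Submodule k B) (f : X →₀ X →₀ S) (x y : X) :
    (colsEquiv X S f : FMat X B).entry x y = f y x := rfl

variable [IsScalarTower k B B] [SMulCommClass k B B]

theorem entry_rowsEquiv_mul_colsEquiv (S T : Submodule k B) (f : X →₀ X →₀ S)
    (g : X →₀ X →₀ T) (x z : X) :
    (rowsEquiv X S f * colsEquiv X T g : FMat X B).entry x z =
      powPairing X (mulPairing S T) (f x) (g z) := by
  classical
  let Y := (rowsEquiv X S f : FMat X B).cols ∪ (f x).support
  rw [entry_mul_of_subset _ _ _ _ (Finset.subset_union_left : _ ⊆ Y), powPairing_apply,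
    Finsupp.sum_of_support_subset _ (Finset.subset_union_right : _ ⊆ Y) _ (by simp)]
  simp only [entry_rowsEquiv, entry_colsEquiv, mulPairing_apply]

theorem exists_component_equiv {S S' T T' : Submodule k B}
    (h : PairingEquiv (powPairing X (mulPairing S S')) (powPairing X (mulPairing T T'))) :
    ∃ (ρ : component X S ≃ₗ[k] component X T) (σ : component X S' ≃ₗ[k] component X T'),
      ∀ a b, (ρ a * σ b : FMat X B) = a * b := by
  obtain ⟨R, L, hRL⟩ := h
  refine ⟨(rowsEquiv X S).symm.trans ((Finsupp.mapRange.linearEquiv R).trans (rowsEquiv X T)),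
    (colsEquiv X S').symm.trans ((Finsupp.mapRange.linearEquiv L.symm).trans (colsEquiv X T')),
    fun a b => ?_⟩
  obtain ⟨f, rfl⟩ := (rowsEquiv X S).surjective a
  obtain ⟨g, rfl⟩ := (colsEquiv X S').surjective b
  ext x z
  simp [entry_rowsEquiv_mul_colsEquiv, hRL]

theorem component_spanMul (S T : Submodule k B) :
    component X (S ⊙ T) = component X S ⊙ component X T := by
  apply le_antisymm
  · refine component_le fun x y => spanMul_le.2 fun s hs t ht => ?_
    have := mul_mem_spanMul (single_mem_component x x hs) (single_mem_component x y ht)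
    rwa [single_mul_single, if_pos rfl] at this
  · refine spanMul_le.2 fun a ha b hb x z => ?_
    rw [entry_mul]
    exact Submodule.sum_mem _ fun y _ => mul_mem_spanMul (ha x y) (hb y z)

theorem isUnitalContext_component {M N : Submodule k B} (h : IsUnitalContext M N) :
    IsUnitalContext (component X M) (component X N) where
  units_left := by
    rw [← component_spanMul]
    exact hasCommonUnits_component h.units_left
  units_right := by
    rw [← component_spanMul]
    exact hasCommonUnits_component h.units_right
  mul_left := by rw [← component_spanMul, ← component_spanMul, h.mul_left]
  mul_right := by rw [← component_spanMul, ← component_spanMul, h.mul_right]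

theorem nonempty_invertibleMultiplier_component {ι ι' : Type*} [Infinite X]
    {M N : Submodule k B} {e : ι → B} {e' : ι' → B} (h : IsUnitalContext M N)
    (he : IsLocalUnitFamily (M ⊙ N) e) (he' : IsLocalUnitFamily (N ⊙ M) e')
    (f : ι × ℕ ↪ X) (f' : ι' × ℕ ↪ X) :
    Nonempty (InvertibleMultiplier (component X M) (component X N)) := by
  have := exists_component_equiv (h.pairingEquiv he he' f f')
  rw [component_spanMul] at this
  obtain ⟨ρ, σ, hρσ⟩ := this
  exact (isUnitalContext_component h).nonempty_invertibleMultiplier hρσ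

end Rows

section Graded

variable {X k B G : Type*} [CommRing k] [NonUnitalRing B] [Module k B] [DecidableEq G]

theorem isInternal_component {𝓑 : G → Submodule k B} (h : DirectSum.IsInternal 𝓑) :
    DirectSum.IsInternal fun g => component X (𝓑 g) := by
  refine DirectSum.isInternal_submodule_of_iSupIndep_of_iSup_eq_top (fun g => ?_) ?_
  · refine Submodule.disjoint_def.2 fun a ha ha' => FMat.ext fun x y => ?_
    let entryₗ : FMat X B →ₗ[k] B := (Finsupp.lapply (x, y) : (X × X →₀ B) →ₗ[k] B)
    have : (⨆ j, ⨆ (_ : j ≠ g), component X (𝓑 j)) ≤ (⨆ j, ⨆ (_ : j ≠ g), 𝓑 j).comap entryₗ :=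
      iSup₂_le fun j hj b hb => le_iSup₂ (f := fun j (_ : j ≠ g) => 𝓑 j) j hj (hb x y)
    exact Submodule.disjoint_def.1 (h.submodule_iSupIndep g) _ (ha x y) (this ha')
  · have : component X (⨆ g, 𝓑 g) ≤ ⨆ g, component X (𝓑 g) :=
      component_le fun x y => iSup_le fun g b hb =>
        le_iSup (fun g => component X (𝓑 g)) g (single_mem_component x y hb)
    rw [h.submodule_iSup_eq_top] at this
    exact top_unique fun a _ => this fun _ _ => trivial

theorem isGrading_component [Group G] {𝓑 : G → Submodule k B} (h : IsGrading 𝓑) :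
    IsGrading fun g => component X (𝓑 g) where
  internal := isInternal_component h.internal
  mul_mem ha hb x z := Submodule.sum_mem _ fun y _ => h.mul_mem (ha x y) (hb y z)

end Graded

section Subalgebra

variable {k B : Type*} [CommRing k] [NonUnitalRing B] [Module k B]

/-- The inclusion of the matrices over a subalgebra, as a linear map. -/
def subalgebraInclusionLinear (X : Type*) (A : NonUnitalSubalgebra k B) :
    FMat X A →ₗ[k] FMat X B :=
  (Finsupp.mapRange.linearMap A.toSubmodule.subtype : (X × X →₀ A) →ₗ[k] (X × X →₀ B))

variable {X : Type*} {A : NonUnitalSubalgebra k B}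

theorem subalgebraInclusionLinear_mul (a b : FMat X A) :
    subalgebraInclusionLinear X A (a * b) =
      subalgebraInclusionLinear X A a * subalgebraInclusionLinear X A b := by
  classical
  ext x z
  let Y := a.cols ∪ (subalgebraInclusionLinear X A a).cols
  change (((a * b).entry x z : A) : B) = _
  rw [entry_mul_of_subset a b _ _ (Finset.subset_union_left : _ ⊆ Y),
    entry_mul_of_subset _ _ _ _ (Finset.subset_union_right : _ ⊆ Y),
    AddSubmonoidClass.coe_finsetSum]
  rfl

/-- The inclusion of the matrices over a subalgebra. -/
def subalgebraInclusion (X : Type*) (A : NonUnitalSubalgebra k B) :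
    FMat X A →ₙₐ[k] FMat X B where
  toFun := subalgebraInclusionLinear X A
  map_smul' := map_smul _
  map_zero' := map_zero _
  map_add' := map_add _
  map_mul' := subalgebraInclusionLinear_mul

theorem subalgebraInclusion_injective : Function.Injective (subalgebraInclusion X A) :=
  fun _ _ h => FMat.ext fun x y => Subtype.ext (congrArg (fun c : FMat X B => c.entry x y) h)

theorem mem_range_subalgebraInclusion {c : FMat X B} :
    c ∈ Set.range (subalgebraInclusion X A) ↔ c ∈ component X A.toSubmodule := by
  constructor
  · rintro ⟨a, rfl⟩
    exact fun x y => (a.entry x y).2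
  · intro hc
    obtain ⟨f, hf⟩ := (entriesEquiv X A.toSubmodule).surjective ⟨c, hc⟩
    exact ⟨f, congrArg Subtype.val hf⟩

end Subalgebra

end FMat

/-! ### Homogeneous formal units -/

section GradedUnits

variable {k G C : Type*} [CommRing k] [NonUnitalRing C] [Module k C]
  [IsScalarTower k C C] [SMulCommClass k C C]

namespace InvertibleMultiplier

variable {M N : Submodule k C} (u : InvertibleMultiplier M N) {S T : Submodule k C}

theorem rightMul_mem_spanMul_top {c : C} (hc : c ∈ ⊤ ⊙ N) (hS : c ∈ S ⊙ ⊤) :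
    u.rightMul c ∈ S ⊙ ⊤ := by
  have := u.rightMul_mem hc hS
  rw [spanMul_assoc] at this
  exact spanMul_mono le_rfl le_top this

theorem leftMul_mem_top_spanMul {b : C} (hb : b ∈ N ⊙ ⊤) (hS : b ∈ ⊤ ⊙ S) :
    u.leftMul b ∈ ⊤ ⊙ S := by
  have := u.leftMul_mem hb hS
  rw [← spanMul_assoc] at this
  exact spanMul_mono le_top le_rfl this

/-- The restriction of `c ↦ c u` to submodules that it maps onto each other. -/
def rightEquiv (hS : S ≤ ⊤ ⊙ N) (hST : ∀ c ∈ S, u.rightMul c ∈ T) (hT : T ≤ ⊤ ⊙ M)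
    (hTS : ∀ c ∈ T, u.symm.rightMul c ∈ S) : S ≃ₗ[k] T where
  toFun c := ⟨u.rightMul c, hST c c.2⟩
  invFun c := ⟨u.symm.rightMul c, hTS c c.2⟩
  map_add' a b := Subtype.ext (u.rightMul_add (hS a.2) (hS b.2))
  map_smul' t a := Subtype.ext (u.rightMul_smul t (hS a.2))
  left_inv c := Subtype.ext (u.symm_rightMul_rightMul (hS c.2))
  right_inv c := Subtype.ext (u.symm.symm_rightMul_rightMul (hT c.2))

/-- The restriction of `b ↦ u b` to submodules that it maps onto each other. -/
def leftEquiv (hS : S ≤ N ⊙ ⊤) (hST : ∀ b ∈ S, u.leftMul b ∈ T) (hT : T ≤ M ⊙ ⊤)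
    (hTS : ∀ b ∈ T, u.symm.leftMul b ∈ S) : S ≃ₗ[k] T where
  toFun b := ⟨u.leftMul b, hST b b.2⟩
  invFun b := ⟨u.symm.leftMul b, hTS b b.2⟩
  map_add' a b := Subtype.ext (u.leftMul_add (hS a.2) (hS b.2))
  map_smul' t a := Subtype.ext (u.leftMul_smul t (hS a.2))
  left_inv b := Subtype.ext (u.symm_leftMul_leftMul (hS b.2))
  right_inv b := Subtype.ext (u.symm.symm_leftMul_leftMul (hT b.2))

end InvertibleMultiplier

/-- The elements `c` of `C_f` with `c ∈ D_a C` for all `a ∈ s`, where `D_a = C_a ⊙ C_{a⁻¹}`. -/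
def supportedPart (𝓒 : G → Submodule k C) (s : Set G) (f : G) : Submodule k C :=
  𝓒 f ⊓ ⨅ a ∈ s, 𝓒 a ⊙ ⊤

theorem mem_supportedPart {𝓒 : G → Submodule k C} {s : Set G} {f : G} {c : C} :
    c ∈ supportedPart 𝓒 s f ↔ c ∈ 𝓒 f ∧ ∀ a ∈ s, c ∈ 𝓒 a ⊙ ⊤ := by
  simp only [supportedPart, Submodule.mem_inf, Submodule.mem_iInf]

theorem supportedPart_anti {𝓒 : G → Submodule k C} {s t : Set G} (hst : s ⊆ t) {f : G} :
    supportedPart 𝓒 t f ≤ supportedPart 𝓒 s f := fun _ hc => by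
  rw [mem_supportedPart] at hc ⊢
  exact ⟨hc.1, fun e he => hc.2 e (hst he)⟩

variable [Group G]

/-- A multiplicative family `C_g = 𝓒 g` of submodules with formal invertible elements `u_g` such
that `C_g = (C_g ⊙ C_{g⁻¹}) u_g` and `u_1 = 1`. -/
structure HomogeneousUnits (𝓒 : G → Submodule k C) where
  mul_mem : ∀ {g h : G} {a b : C}, a ∈ 𝓒 g → b ∈ 𝓒 h → a * b ∈ 𝓒 (g * h)
  u : ∀ g, InvertibleMultiplier (𝓒 g) (𝓒 g⁻¹)
  rightMul_one : ∀ c ∈ ⊤ ⊙ 𝓒 1⁻¹, (u 1).rightMul c = c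

namespace HomogeneousUnits

variable {𝓒 : G → Submodule k C} (K : HomogeneousUnits 𝓒) {N : Submodule k C} {s t : Set G}
  {f f' g h : G} {a b c : C}
include K

theorem spanMul_le (g h : G) : 𝓒 g ⊙ 𝓒 h ≤ 𝓒 (g * h) :=
  _root_.spanMul_le.2 fun _ ha _ hb => K.mul_mem ha hb

theorem mem_top_spanMul {e : G} (hf : c ∈ 𝓒 f) (he : c ∈ 𝓒 e ⊙ ⊤) : c ∈ ⊤ ⊙ 𝓒 (e⁻¹ * f) := by
  obtain ⟨d, hd, hdc⟩ := (K.u e).context.exists_left_unit he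
  have := mul_mem_spanMul hd hf
  rw [hdc, spanMul_assoc] at this
  exact spanMul_mono le_top (K.spanMul_le _ _) this

theorem mem_one_spanMul_top (hf : c ∈ 𝓒 f) : c ∈ 𝓒 1 ⊙ ⊤ := by
  rw [← (K.u f).context.mul_left] at hf
  exact spanMul_mono (by simpa using K.spanMul_le f f⁻¹) le_top hf

theorem one_mul_mem_spanMul_top (ha : a ∈ 𝓒 1) (hc : c ∈ 𝓒 g ⊙ ⊤) : a * c ∈ 𝓒 g ⊙ ⊤ := by
  have := mul_mem_spanMul ha hc
  rw [← spanMul_assoc] at this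
  exact spanMul_mono (by simpa using K.spanMul_le 1 g) le_rfl this

theorem supportedPart_le_domain (hs : f * g ∈ s) :
    supportedPart 𝓒 s f ≤ ⊤ ⊙ 𝓒 g⁻¹ := fun c hc => by
  rw [mem_supportedPart] at hc
  simpa [mul_assoc] using K.mem_top_spanMul hc.1 (hc.2 _ hs)

theorem rightMul_mem (u : InvertibleMultiplier (𝓒 g) N) (hN : c ∈ ⊤ ⊙ N)
    (hc : c ∈ supportedPart 𝓒 s f) : u.rightMul c ∈ supportedPart 𝓒 s (f * g) := by
  rw [mem_supportedPart] at hc ⊢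
  exact ⟨K.spanMul_le _ _ (u.rightMul_mem hN hc.1),
    fun e he => u.rightMul_mem_spanMul_top hN (hc.2 e he)⟩

theorem leftMul_mem_spanMul_top {e : G} (u : InvertibleMultiplier (𝓒 g) N) (hN : c ∈ N ⊙ ⊤)
    (hc : c ∈ 𝓒 e ⊙ ⊤) : u.leftMul c ∈ 𝓒 (g * e) ⊙ ⊤ := by
  have := u.leftMul_mem hN hc
  rw [← spanMul_assoc] at this
  exact spanMul_mono (K.spanMul_le g e) le_rfl this

theorem leftMul_mem (u : InvertibleMultiplier (𝓒 g) N) (hN : c ∈ N ⊙ ⊤)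
    (hst : ∀ e ∈ t, g⁻¹ * e ∈ s) (hc : c ∈ supportedPart 𝓒 s f) :
    u.leftMul c ∈ supportedPart 𝓒 t (g * f) := by
  rw [mem_supportedPart] at hc ⊢
  exact ⟨K.spanMul_le _ _ (u.leftMul_mem hN hc.1), fun e he => by
    simpa using K.leftMul_mem_spanMul_top u hN (hc.2 _ (hst e he))⟩

/-- The bijection `c ↦ c u_g` between the parts of degrees `f` and `f g = f'`. -/
def rightEquiv (hf : f ∈ s) (hf' : f' ∈ s) (hfg : f * g = f') :
    supportedPart 𝓒 s f ≃ₗ[k] supportedPart 𝓒 s f' :=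
  have hS : supportedPart 𝓒 s f ≤ ⊤ ⊙ 𝓒 g⁻¹ := K.supportedPart_le_domain (hfg ▸ hf')
  have hT : supportedPart 𝓒 s f' ≤ ⊤ ⊙ 𝓒 g := by
    simpa using K.supportedPart_le_domain (f := f') (g := g⁻¹) (by simpa [← hfg])
  (K.u g).rightEquiv hS (fun _ hc => hfg ▸ K.rightMul_mem _ (hS hc) hc) hT
    (fun _ hc => by simpa [← hfg] using K.rightMul_mem (K.u g).symm (hT hc) hc)

/-- The bijection `c ↦ u_g c` between the parts of degrees `f` and `g f = f'`. -/
def leftEquiv (hs : 1 ∈ s) (ht : 1 ∈ t) (hst : ∀ e, e ∈ s ↔ g * e ∈ t) (hgf : g * f = f') :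
    supportedPart 𝓒 s f ≃ₗ[k] supportedPart 𝓒 t f' :=
  have hS : supportedPart 𝓒 s f ≤ 𝓒 g⁻¹ ⊙ ⊤ := fun _ hc =>
    (mem_supportedPart.1 hc).2 _ ((hst _).2 (by simpa))
  have hT : supportedPart 𝓒 t f' ≤ 𝓒 g ⊙ ⊤ := fun _ hc =>
    (mem_supportedPart.1 hc).2 _ (by simpa [hst] using hs)
  (K.u g).leftEquiv hS
    (fun _ hc => hgf ▸ K.leftMul_mem (K.u g) (hS hc) (fun e he => (hst _).2 (by simpa)) hc) hT
    (fun _ hc => by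
      simpa [← hgf] using K.leftMul_mem (K.u g).symm (hT hc) (fun e he => by simpa [← hst]) hc)

/-- `θ_g(c) = u_g c u_g⁻¹`. -/
def θ (g : G) (c : C) : C := (K.u g).leftMul ((K.u g).symm.rightMul c)

/-- `c w_{g,h} = c u_g u_h u_{gh}⁻¹`. -/
def rightTwist (g h : G) (c : C) : C :=
  (K.u (g * h)).symm.rightMul ((K.u h).rightMul ((K.u g).rightMul c))

/-- `w_{g,h} c = u_g u_h u_{gh}⁻¹ c`. -/
def leftTwist (g h : G) (c : C) : C :=
  (K.u g).leftMul ((K.u h).leftMul ((K.u (g * h)).symm.leftMul c))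

/-- `θ_g : D_{g⁻¹} → D_g` as a linear equivalence. -/
def θEquiv (g : G) : supportedPart 𝓒 {1, g⁻¹} 1 ≃ₗ[k] supportedPart 𝓒 {1, g} 1 :=
  (K.rightEquiv (g := g) (f := g⁻¹) (by simp) (by simp) (by simp)).symm.trans
    (K.leftEquiv (g := g) (by simp) (by simp) (by simp [or_comm, mul_eq_one_iff_eq_inv'])
      (by simp))

/-- `c ↦ c w_{g,h}` as a linear automorphism of `D_g ∩ D_{gh}`. -/
def rightTwistEquiv (g h : G) :
    supportedPart 𝓒 {1, g, g * h} 1 ≃ₗ[k] supportedPart 𝓒 {1, g, g * h} 1 :=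
  (K.rightEquiv (g := g) (f' := g) (by simp) (by simp) (by simp)).trans
    ((K.rightEquiv (g := h) (f' := g * h) (by simp) (by simp) rfl).trans
    (K.rightEquiv (g := g * h) (by simp) (by simp) (by simp)).symm)

/-- `c ↦ w_{g,h} c` as a linear automorphism of `D_g ∩ D_{gh}`. -/
def leftTwistEquiv (g h : G) :
    supportedPart 𝓒 {1, g, g * h} 1 ≃ₗ[k] supportedPart 𝓒 {1, g, g * h} 1 :=
  let s : Set G := {1, g, g * h}
  (K.leftEquiv (g := g * h) (s := {e | g * h * e ∈ s}) (f := (g * h)⁻¹) (by simp [s]) (by simp)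
      (by simp [s]) (by simp)).symm.trans
    ((K.leftEquiv (g := h) (t := {e | g * e ∈ s}) (f' := g⁻¹) (by simp [s]) (by simp [s])
      (by simp [s, mul_assoc]) (by simp)).trans
    (K.leftEquiv (g := g) (by simp [s]) (by simp) (by simp [s]) (by simp)))

theorem θ_mem (hs : g⁻¹ ∈ s) (hst : ∀ e ∈ t, g⁻¹ * e ∈ s) (hc : c ∈ supportedPart 𝓒 s 1) :
    K.θ g c ∈ supportedPart 𝓒 t 1 := by
  have hg : c ∈ ⊤ ⊙ 𝓒 g := by
    simpa using K.supportedPart_le_domain (f := 1) (g := g⁻¹) (by simpa) hc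
  have hR := K.rightMul_mem (K.u g).symm hg hc
  simpa [θ] using K.leftMul_mem (K.u g) ((mem_supportedPart.1 hR).2 _ hs) hst hR

section Conjugation

variable (hc : c ∈ 𝓒 1) (hg : c ∈ 𝓒 g⁻¹ ⊙ ⊤)
include hc hg

theorem mem_top_spanMul_of_one : c ∈ ⊤ ⊙ 𝓒 g := by
  simpa using K.mem_top_spanMul hc hg

theorem rightMul_θ : (K.u g).rightMul (K.θ g c) = (K.u g).leftMul c := by
  have hg' := K.mem_top_spanMul_of_one hc hg
  rw [θ, (K.u g).leftMul_rightMul (K.u g).symm hg hg']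
  exact (K.u g).symm.symm_rightMul_rightMul ((K.u g).leftMul_mem_top_spanMul hg hg')

theorem θ_mem_spanMul_top_iff : K.θ g c ∈ 𝓒 (g * h) ⊙ ⊤ ↔ c ∈ 𝓒 h ⊙ ⊤ := by
  have hc' := K.mem_top_spanMul_of_one hc hg
  have hR := (K.u g).symm.rightMul_mem_spanMul_top hc' hg
  have hθ : K.θ g c ∈ 𝓒 g ⊙ ⊤ := (K.u g).leftMul_mem_top hR
  refine ⟨fun h => ?_, fun hh =>
    K.leftMul_mem_spanMul_top (K.u g) hR ((K.u g).symm.rightMul_mem_spanMul_top hc' hh)⟩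
  have := K.leftMul_mem_spanMul_top (K.u g).symm hθ h
  rw [θ, (K.u g).symm_leftMul_leftMul hR, inv_mul_cancel_left] at this
  have := (K.u g).rightMul_mem_spanMul_top ((K.u g).symm.rightMul_mem_top hc') this
  rwa [show (K.u g).rightMul _ = c from (K.u g).symm.symm_rightMul_rightMul hc'] at this

theorem θ_mul {d : C} (hd : d ∈ 𝓒 1) (hdg : d ∈ 𝓒 g⁻¹ ⊙ ⊤) :
    K.θ g (c * d) = K.θ g c * K.θ g d := by
  have hd' := K.mem_top_spanMul_of_one hd hdg
  have hc' := K.mem_top_spanMul_of_one hc hg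
  have hθ : K.θ g c ∈ ⊤ ⊙ 𝓒 g⁻¹ := (K.u g).leftMul_mem_top_spanMul
    ((K.u g).symm.rightMul_mem_spanMul_top hc' hg) ((K.u g).symm.rightMul_mem_top hc')
  calc K.θ g (c * d) = (K.u g).leftMul (c * (K.u g).symm.rightMul d) := by
        rw [θ, (K.u g).symm.rightMul_mul_left c hd']
    _ = (K.u g).rightMul (K.θ g c) * (K.u g).symm.rightMul d := by
        rw [(K.u g).leftMul_mul_right hg, K.rightMul_θ hc hg]
    _ = K.θ g c * K.θ g d :=
        (K.u g).rightMul_mul hθ ((K.u g).symm.rightMul_mem_spanMul_top hd' hdg)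

end Conjugation

theorem leftMul_one (hc : c ∈ 𝓒 1⁻¹ ⊙ ⊤) : (K.u 1).leftMul c = c := by
  have hc' : c ∈ 𝓒 1 ⊙ ⊤ := by simpa using hc
  refine sub_eq_zero.1 <| (K.u 1).context.eq_zero_of_mul_left
    (sub_mem ((K.u 1).leftMul_mem_top hc) hc') fun n hn => ?_
  have hn := (K.u 1).context.le_top_mul hn
  rw [mul_sub, ← (K.u 1).rightMul_mul hn hc, K.rightMul_one n hn, sub_self]

theorem θ_one (hc : c ∈ 𝓒 1) : K.θ 1 c = c := by
  have h₁ : c ∈ ⊤ ⊙ 𝓒 1⁻¹ := (K.u 1).context.le_top_mul (by simpa)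
  have h₂ : c ∈ 𝓒 1⁻¹ ⊙ ⊤ := (K.u 1).context.le_mul_top (by simpa)
  have : (K.u 1).symm.rightMul c = c := by
    conv_lhs => rw [← K.rightMul_one c h₁]
    exact (K.u 1).symm_rightMul_rightMul h₁
  rw [θ, this, K.leftMul_one h₂]

theorem rightTwist_domain (hc : c ∈ supportedPart 𝓒 {1, g, g * h} 1) :
    c ∈ ⊤ ⊙ 𝓒 g⁻¹ ∧ (K.u g).rightMul c ∈ ⊤ ⊙ 𝓒 h⁻¹ ∧
      (K.u h).rightMul ((K.u g).rightMul c) ∈ ⊤ ⊙ 𝓒 (g * h) := by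
  have h₁ : c ∈ ⊤ ⊙ 𝓒 g⁻¹ := K.supportedPart_le_domain (by simp) hc
  have hR := K.rightMul_mem (K.u g) h₁ hc
  have h₂ := K.supportedPart_le_domain (g := h) (by simp) hR
  have hRR := (mem_supportedPart.1 (K.rightMul_mem (K.u h) h₂ hR)).1
  exact ⟨h₁, h₂, (K.u (g * h)).context.symm.le_top_mul (by simpa using hRR)⟩

theorem leftTwist_domain (hc : c ∈ supportedPart 𝓒 {1, g, g * h} 1) :
    c ∈ 𝓒 (g * h) ⊙ ⊤ ∧ (K.u (g * h)).symm.leftMul c ∈ 𝓒 h⁻¹ ⊙ ⊤ ∧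
      (K.u h).leftMul ((K.u (g * h)).symm.leftMul c) ∈ 𝓒 g⁻¹ ⊙ ⊤ := by
  have h₁ : c ∈ 𝓒 (g * h) ⊙ ⊤ := (mem_supportedPart.1 hc).2 _ (by simp)
  have hL := K.leftMul_mem (t := {h⁻¹, (g * h)⁻¹}) (K.u (g * h)).symm h₁ (by simp) hc
  have h₂ := (mem_supportedPart.1 hL).2 h⁻¹ (by simp)
  have hLL := K.leftMul_mem (t := {g⁻¹}) (K.u h) h₂ (by simp) hL
  exact ⟨h₁, h₂, (mem_supportedPart.1 hLL).2 g⁻¹ rfl⟩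

theorem rightTwist_mem (hs : g ∈ s) (hs' : g * h ∈ s) (hs₁ : 1 ∈ s)
    (hc : c ∈ supportedPart 𝓒 s 1) : K.rightTwist g h c ∈ supportedPart 𝓒 s 1 :=
  ((K.rightEquiv (f' := g) hs₁ hs (by simp)).trans
    ((K.rightEquiv (g := h) hs hs' rfl).trans
    (K.rightEquiv (g := g * h) hs₁ hs' (by simp)).symm) ⟨c, hc⟩).2

theorem rightTwist_mul_left (a : C) (hc : c ∈ supportedPart 𝓒 {1, g, g * h} 1) :
    K.rightTwist g h (a * c) = a * K.rightTwist g h c := by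
  obtain ⟨h₁, h₂, h₃⟩ := K.rightTwist_domain hc
  rw [rightTwist, (K.u g).rightMul_mul_left a h₁, (K.u h).rightMul_mul_left a h₂,
    (K.u (g * h)).symm.rightMul_mul_left a h₃, rightTwist]

theorem leftTwist_mul_right (hc : c ∈ supportedPart 𝓒 {1, g, g * h} 1) (a : C) :
    K.leftTwist g h (c * a) = K.leftTwist g h c * a := by
  obtain ⟨h₁, h₂, h₃⟩ := K.leftTwist_domain hc
  rw [leftTwist, (K.u (g * h)).symm.leftMul_mul_right h₁ a, (K.u h).leftMul_mul_right h₂ a,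
    (K.u g).leftMul_mul_right h₃ a, leftTwist]

theorem rightTwist_mul (ha : a ∈ supportedPart 𝓒 {1, g, g * h} 1)
    (hb : b ∈ supportedPart 𝓒 {1, g, g * h} 1) :
    K.rightTwist g h a * b = a * K.leftTwist g h b := by
  obtain ⟨ha₁, ha₂, ha₃⟩ := K.rightTwist_domain ha
  obtain ⟨hb₁, hb₂, hb₃⟩ := K.leftTwist_domain hb
  rw [rightTwist, (K.u (g * h)).symm.rightMul_mul ha₃ hb₁, (K.u h).rightMul_mul ha₂ hb₂,
    (K.u g).rightMul_mul ha₁ hb₃, leftTwist]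

theorem rightMul_rightTwist (hc : c ∈ supportedPart 𝓒 {1, g, g * h} 1) :
    (K.u (g * h)).rightMul (K.rightTwist g h c) = (K.u h).rightMul ((K.u g).rightMul c) :=
  (K.u (g * h)).symm.symm_rightMul_rightMul (K.rightTwist_domain hc).2.2

theorem rightMul_rightTwist_θ_mul (ha : a ∈ 𝓒 1) (hag : a ∈ 𝓒 g⁻¹ ⊙ ⊤) (hb : b ∈ 𝓒 1)
    (hbh : b ∈ 𝓒 h ⊙ ⊤) : (K.u (g * h)).rightMul (K.rightTwist g h (K.θ g (a * b))) =
      (K.u g).rightMul (K.θ g a) * (K.u h).rightMul b := by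
  have hab : a * b ∈ 𝓒 1 := by simpa using K.mul_mem ha hb
  have habg : a * b ∈ 𝓒 g⁻¹ ⊙ ⊤ := mul_mem_spanMul_top hag b
  have habh : a * b ∈ 𝓒 h ⊙ ⊤ := K.one_mul_mem_spanMul_top ha hbh
  have hθ : K.θ g (a * b) ∈ supportedPart 𝓒 {1, g, g * h} 1 :=
    K.θ_mem (s := {1, g⁻¹, h}) (by simp) (by simp)
      (by simp [mem_supportedPart, *, K.mem_one_spanMul_top hab])
  have hbh' : b ∈ ⊤ ⊙ 𝓒 h⁻¹ := by simpa using K.mem_top_spanMul hb hbh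
  rw [K.rightMul_rightTwist hθ, K.rightMul_θ hab habg, K.rightMul_θ ha hag,
    (K.u g).leftMul_mul_right hag, (K.u h).rightMul_mul_left _ hbh']

theorem rightTwist_one_left (hc : c ∈ supportedPart 𝓒 {1, 1, 1 * g} 1) :
    K.rightTwist 1 g c = c := by
  obtain ⟨h₁, h₂, -⟩ := K.rightTwist_domain hc
  rw [K.rightMul_one c h₁] at h₂
  rw [rightTwist, one_mul, K.rightMul_one c h₁, (K.u g).symm_rightMul_rightMul h₂]

theorem rightTwist_one_right (hc : c ∈ supportedPart 𝓒 {1, g, g * 1} 1) :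
    K.rightTwist g 1 c = c := by
  obtain ⟨h₁, h₂, -⟩ := K.rightTwist_domain hc
  rw [rightTwist, mul_one, K.rightMul_one _ h₂, (K.u g).symm_rightMul_rightMul h₁]

theorem leftTwist_one_left (hc : c ∈ supportedPart 𝓒 {1, 1, 1 * g} 1) :
    K.leftTwist 1 g c = c := by
  obtain ⟨h₁, -, h₃⟩ := K.leftTwist_domain hc
  rw [leftTwist, K.leftMul_one h₃]
  rw [one_mul] at h₁ ⊢
  exact (K.u g).symm.symm_leftMul_leftMul h₁

theorem leftTwist_one_right (hc : c ∈ supportedPart 𝓒 {1, g, g * 1} 1) :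
    K.leftTwist g 1 c = c := by
  obtain ⟨h₁, h₂, -⟩ := K.leftTwist_domain hc
  rw [leftTwist, K.leftMul_one h₂]
  rw [mul_one] at h₁ ⊢
  exact (K.u g).symm.symm_leftMul_leftMul h₁

theorem rightTwist_θ_θ (hc : c ∈ 𝓒 1) (hh : c ∈ 𝓒 h⁻¹ ⊙ ⊤) (hgh : c ∈ 𝓒 (g * h)⁻¹ ⊙ ⊤) :
    K.rightTwist g h (K.θ g (K.θ h c)) = K.leftTwist g h (K.θ (g * h) c) := by
  have hθ : K.θ h c ∈ supportedPart 𝓒 {h, g⁻¹} 1 := K.θ_mem (s := {1, h⁻¹, (g * h)⁻¹})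
    (by simp) (by simp) (by simp [mem_supportedPart, -mul_inv_rev, *, K.mem_one_spanMul_top hc])
  simp only [mem_supportedPart, Set.mem_insert_iff, Set.mem_singleton_iff, forall_eq_or_imp,
    forall_eq] at hθ
  obtain ⟨hθ₁, hθh, hθg⟩ := hθ
  have hgh' := K.mem_top_spanMul_of_one hc hgh
  have hL : (K.u h).leftMul c ∈ 𝓒 g⁻¹ ⊙ ⊤ := by
    simpa using K.leftMul_mem_spanMul_top (K.u h) hh hgh
  have hR := (K.u (g * h)).symm.rightMul_mem_spanMul_top hgh' hgh
  have hθh' : K.θ h c ∈ ⊤ ⊙ 𝓒 h⁻¹ := by simpa using K.mem_top_spanMul hθ₁ hθh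
  calc K.rightTwist g h (K.θ g (K.θ h c))
      = (K.u (g * h)).symm.rightMul ((K.u h).rightMul ((K.u g).leftMul (K.θ h c))) := by
        rw [rightTwist, K.rightMul_θ hθ₁ hθg]
    _ = (K.u (g * h)).symm.rightMul ((K.u g).leftMul ((K.u h).leftMul c)) := by
        rw [← (K.u g).leftMul_rightMul (K.u h) hθg hθh', K.rightMul_θ hc hh]
    _ = (K.u g).leftMul ((K.u h).leftMul ((K.u (g * h)).symm.rightMul c)) := by
        rw [← (K.u g).leftMul_rightMul (K.u (g * h)).symm hL
          ((K.u h).leftMul_mem_top_spanMul hh hgh'),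
          (K.u h).leftMul_rightMul (K.u (g * h)).symm hh hgh']
    _ = K.leftTwist g h (K.θ (g * h) c) := by
        rw [leftTwist, θ, (K.u (g * h)).symm_leftMul_leftMul hR]

theorem rightTwist_cocycle (hc : c ∈ supportedPart 𝓒 {1, g⁻¹, h, h * f} 1) :
    K.rightTwist g (h * f) (K.θ g (K.rightTwist h f c)) =
      K.rightTwist (g * h) f (K.rightTwist g h (K.θ g c)) := by
  have hc' : c ∈ supportedPart 𝓒 {1, h, h * f} 1 := supportedPart_anti (by grind) hc
  obtain ⟨h₁, h₂, -⟩ := K.rightTwist_domain hc'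
  have hc₁ := (mem_supportedPart.1 hc).1
  have hg : c ∈ 𝓒 g⁻¹ ⊙ ⊤ := (mem_supportedPart.1 hc).2 _ (by simp)
  have hw := K.rightTwist_mem (g := h) (h := f) (by simp) (by simp) (by simp) hc
  have hwg := (mem_supportedPart.1 hw).2 g⁻¹ (by simp)
  have hwf := K.supportedPart_le_domain (f := 1) (g := h * f) (by simp) hw
  have hθ : K.θ g c ∈ supportedPart 𝓒 {1, g, g * h} 1 := K.θ_mem (by simp) (by simp) hc
  have hR := (K.u h).rightMul_mem_spanMul_top h₁ hg
  calc K.rightTwist g (h * f) (K.θ g (K.rightTwist h f c))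
      = (K.u (g * (h * f))).symm.rightMul
          ((K.u g).leftMul ((K.u f).rightMul ((K.u h).rightMul c))) := by
        rw [rightTwist, K.rightMul_θ (mem_supportedPart.1 hw).1 hwg,
          ← (K.u g).leftMul_rightMul (K.u (h * f)) hwg hwf, K.rightMul_rightTwist hc']
    _ = (K.u (g * h * f)).symm.rightMul
          ((K.u f).rightMul ((K.u h).rightMul ((K.u g).leftMul c))) := by
        rw [mul_assoc, (K.u g).leftMul_rightMul (K.u f) hR h₂,
          (K.u g).leftMul_rightMul (K.u h) hg h₁]
    _ = K.rightTwist (g * h) f (K.rightTwist g h (K.θ g c)) := by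
        rw [rightTwist, K.rightMul_rightTwist hθ, K.rightMul_θ hc₁ hg]

end HomogeneousUnits
end GradedUnits

theorem TwistedPartialAction.mulComponent_θ {k G A : Type*} [CommRing k] [Group G]
    [NonUnitalRing A] [Module k A] [IsScalarTower k A A] [SMulCommClass k A A]
    (Θ : TwistedPartialAction k G A) (g h : G) (a : Θ.D g⁻¹) (b : Θ.D h) :
    (Θ.mulComponent g h ((Θ.θ g).toLinearEquiv a) b : A) =
      (Θ.w g h).val.right (Θ.θRestrict g h (Θ.pairing g h a b)) := by
  simp only [mulComponent, LinearMap.compr₂_apply, LinearMap.comp_apply, LinearEquiv.coe_coe,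
    LinearEquiv.symm_apply_apply]
  rfl

/-! ### The crossed product decomposition -/

section CrossedProductDecomposition

/-- A multiplier whose two components are bijective is invertible. -/
def Multiplier.unitOfEquiv {k I : Type*} [CommRing k] [NonUnitalRing I] [Module k I]
    (R L : I ≃ₗ[k] I) (hR : ∀ a b, R (a * b) = a * R b) (hL : ∀ a b, L (a * b) = L a * b)
    (hRL : ∀ a b, R a * b = a * L b) : (Multiplier k I)ˣ where
  val := ⟨R, L, hR, hL, hRL⟩
  inv := ⟨R.symm, L.symm,
    fun a b => R.injective (by simp [hR]), fun a b => L.injective (by simp [hL]),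
    fun a b => by simpa using (hRL (R.symm a) (L.symm b)).symm⟩
  val_inv := Multiplier.ext (LinearMap.ext R.symm_apply_apply) (LinearMap.ext L.apply_symm_apply)
  inv_val := Multiplier.ext (LinearMap.ext R.apply_symm_apply) (LinearMap.ext L.symm_apply_apply)

variable {k A C : Type*} [CommRing k] [NonUnitalRing A] [Module k A] [NonUnitalRing C] [Module k C]

/-- `ι` identifies the algebra `A` with the submodule `S` of `C`. -/
structure IsIdentification (ι : A →ₙₐ[k] C) (S : Submodule k C) : Prop where
  injective : Function.Injective ι
  mem_range : ∀ {c}, c ∈ Set.range ι ↔ c ∈ S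

namespace IsIdentification

variable {ι : A →ₙₐ[k] C} {S : Submodule k C} (H : IsIdentification ι S)
include H

theorem map_mem (a : A) : ι a ∈ S := H.mem_range.1 ⟨a, rfl⟩

/-- `ι` as an isomorphism from an ideal of `A` onto its image. -/
def idealEquiv {I : AlgIdeal k A} {T : Submodule k C} (hT : T ≤ S) (hI : ∀ {a}, a ∈ I ↔ ι a ∈ T) :
    I ≃ₗ[k] T :=
  LinearEquiv.ofBijective
    ((ι : A →ₗ[k] C).restrict (p := I.toSubmodule) (q := T) fun _ ha => hI.1 ha)
    ⟨fun _ _ h => Subtype.ext (H.injective (congrArg Subtype.val h)), fun c => by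
      obtain ⟨a, ha⟩ := H.mem_range.2 (hT c.2)
      exact ⟨⟨a, hI.2 (ha ▸ c.2)⟩, Subtype.ext ha⟩⟩

end IsIdentification

namespace HomogeneousUnits

variable {G : Type*} [Group G] [IsScalarTower k C C] [SMulCommClass k C C]
  {𝓒 : G → Submodule k C} (K : HomogeneousUnits 𝓒) {ι : A →ₙₐ[k] C}
  (H : IsIdentification ι (𝓒 1))

/-- The ideal `D_g = C_g ⊙ C_{g⁻¹}` of `A`. -/
def dom (g : G) : AlgIdeal k A where
  toSubmodule := (𝓒 g ⊙ ⊤).comap (ι : A →ₗ[k] C)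
  mul_mem_left' a x hx := by
    simpa using K.one_mul_mem_spanMul_top (H.map_mem a) hx
  mul_mem_right' a x hx := by
    simpa using mul_mem_spanMul_top hx (ι a)

theorem mem_dom {g : G} {a : A} : a ∈ K.dom H g ↔ ι a ∈ 𝓒 g ⊙ ⊤ := Iff.rfl

theorem mem_dom_one (a : A) : a ∈ K.dom H 1 := K.mem_one_spanMul_top (H.map_mem a)

theorem map_mem_supportedPart {s : Set G} {a : A} :
    ι a ∈ supportedPart 𝓒 s 1 ↔ ∀ e ∈ s, a ∈ K.dom H e := by
  simp only [mem_supportedPart, mem_dom, H.map_mem, true_and]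

/-- `ι` as an isomorphism from `D_g ⊆ A` onto its image in `C`. -/
def domEquiv (g : G) : K.dom H g ≃ₗ[k] supportedPart 𝓒 {1, g} 1 :=
  H.idealEquiv inf_le_left (by simp [K.map_mem_supportedPart H, mem_dom_one])

theorem map_domEquiv_symm (g : G) (c : supportedPart 𝓒 {1, g} 1) :
    ι ((K.domEquiv H g).symm c) = c :=
  congrArg Subtype.val ((K.domEquiv H g).apply_symm_apply c)

/-- The linear isomorphism `θ_g : D_{g⁻¹} → D_g` between ideals of `A`. -/
def θLinear (g : G) : K.dom H g⁻¹ ≃ₗ[k] K.dom H g :=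
  (K.domEquiv H g⁻¹).trans ((K.θEquiv g).trans (K.domEquiv H g).symm)

theorem map_θLinear (g : G) (a : K.dom H g⁻¹) : ι (K.θLinear H g a) = K.θ g (ι a) :=
  K.map_domEquiv_symm H g _

/-- `θ_g` as an isomorphism of algebras. -/
def θIso (g : G) : NAlgIso k (K.dom H g⁻¹) (K.dom H g) where
  toLinearEquiv := K.θLinear H g
  map_mul' a b := Subtype.ext <| H.injective <| by
    change ι (K.θLinear H g (a * b)) = ι (K.θLinear H g a * K.θLinear H g b)
    simp only [map_mul, map_θLinear, MulMemClass.coe_mul]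
    exact K.θ_mul (H.map_mem _) a.2 (H.map_mem _) b.2

theorem map_θIso (g : G) (a : K.dom H g⁻¹) :
    ι ((K.θIso H g).toLinearEquiv a) = K.θ g (ι a) := K.map_θLinear H g a

theorem θIso_mem_iff (g h : G) (a : K.dom H g⁻¹) :
    ((K.θIso H g).toLinearEquiv a : A) ∈ K.dom H (g * h) ↔ (a : A) ∈ K.dom H h := by
  rw [mem_dom, map_θIso, K.θ_mem_spanMul_top_iff (H.map_mem a) a.2, mem_dom]

/-- The isomorphism `D_g → C_g`, `a ↦ a u_g`. -/
def componentEquiv (g : G) : K.dom H g ≃ₗ[k] 𝓒 g :=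
  (K.domEquiv H g).trans <| (K.rightEquiv (by simp) (by simp) (one_mul g)).trans <|
    LinearEquiv.ofEq _ _ <| le_antisymm inf_le_left fun c hc => by
      simp [mem_supportedPart, hc, K.mem_one_spanMul_top hc, (K.u g).context.symm.le_mul_top hc]

variable [IsScalarTower k A A] [SMulCommClass k A A]

theorem mem_dom_mul {g h : G} {a : A} :
    a ∈ K.dom H g * K.dom H h ↔ a ∈ K.dom H g ∧ a ∈ K.dom H h := by
  refine ⟨fun ha => ⟨AlgIdeal.mul_le_left ha, AlgIdeal.mul_le_right ha⟩, fun ha => ?_⟩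
  obtain ⟨e, he, hea⟩ := (K.u g).context.exists_left_unit ha.1
  obtain ⟨e, rfl⟩ := H.mem_range.2 (by simpa using K.spanMul_le g g⁻¹ he)
  rw [← H.injective ((map_mul ι e a).trans hea)]
  exact AlgIdeal.mul_mem_mul (spanMul_mono le_rfl le_top he) ha.2

/-- `ι` as an isomorphism from `D_g D_{gh} ⊆ A` onto its image in `C`. -/
def domMulEquiv (g h : G) :
    ↥(K.dom H g * K.dom H (g * h)) ≃ₗ[k] supportedPart 𝓒 {1, g, g * h} 1 :=
  H.idealEquiv inf_le_left (by simp [K.map_mem_supportedPart H, mem_dom_mul, mem_dom_one])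

theorem map_domMulEquiv_symm (g h : G) (c : supportedPart 𝓒 {1, g, g * h} 1) :
    ι ((K.domMulEquiv H g h).symm c) = c :=
  congrArg Subtype.val ((K.domMulEquiv H g h).apply_symm_apply c)

theorem map_mem_of_mem_dom_mul {g h : G} (a : ↥(K.dom H g * K.dom H (g * h))) :
    ι a ∈ supportedPart 𝓒 {1, g, g * h} 1 := (K.domMulEquiv H g h a).2

/-- `a ↦ a w_{g,h}` as a linear automorphism of `D_g D_{gh} ⊆ A`. -/
def twistRight (g h : G) :
    ↥(K.dom H g * K.dom H (g * h)) ≃ₗ[k] ↥(K.dom H g * K.dom H (g * h)) :=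
  (K.domMulEquiv H g h).trans ((K.rightTwistEquiv g h).trans (K.domMulEquiv H g h).symm)

theorem map_twistRight (g h : G) (a : ↥(K.dom H g * K.dom H (g * h))) :
    ι (K.twistRight H g h a) = K.rightTwist g h (ι a) := K.map_domMulEquiv_symm H g h _

/-- `a ↦ w_{g,h} a` as a linear automorphism of `D_g D_{gh} ⊆ A`. -/
def twistLeft (g h : G) :
    ↥(K.dom H g * K.dom H (g * h)) ≃ₗ[k] ↥(K.dom H g * K.dom H (g * h)) :=
  (K.domMulEquiv H g h).trans ((K.leftTwistEquiv g h).trans (K.domMulEquiv H g h).symm)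

theorem map_twistLeft (g h : G) (a : ↥(K.dom H g * K.dom H (g * h))) :
    ι (K.twistLeft H g h a) = K.leftTwist g h (ι a) := K.map_domMulEquiv_symm H g h _

/-- `w_{g,h} = u_g u_h u_{gh}⁻¹` as an invertible multiplier of `D_g D_{gh}`. -/
def twist (g h : G) : (Multiplier k ↥(K.dom H g * K.dom H (g * h)))ˣ :=
  Multiplier.unitOfEquiv (K.twistRight H g h) (K.twistLeft H g h)
    (fun a b => Subtype.ext <| H.injective <| by
      simp only [map_twistRight, MulMemClass.coe_mul, map_mul]
      exact K.rightTwist_mul_left _ (K.map_mem_of_mem_dom_mul H b))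
    (fun a b => Subtype.ext <| H.injective <| by
      simp only [map_twistLeft, MulMemClass.coe_mul, map_mul]
      exact K.leftTwist_mul_right (K.map_mem_of_mem_dom_mul H a) _)
    (fun a b => Subtype.ext <| H.injective <| by
      simp only [map_twistRight, map_twistLeft, MulMemClass.coe_mul, map_mul]
      exact K.rightTwist_mul (K.map_mem_of_mem_dom_mul H a) (K.map_mem_of_mem_dom_mul H b))

theorem map_twist_right (g h : G) (a : ↥(K.dom H g * K.dom H (g * h))) :
    ι ((K.twist H g h).val.right a) = K.rightTwist g h (ι a) := K.map_twistRight H g h a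

theorem map_twist_left (g h : G) (a : ↥(K.dom H g * K.dom H (g * h))) :
    ι ((K.twist H g h).val.left a) = K.leftTwist g h (ι a) := K.map_twistLeft H g h a

/-- The domains `D_g` and isomorphisms `θ_g` on `A` of the twisted partial action given by the
formal units `u_g`. -/
def partialActionData : PartialActionData k G A where
  D := K.dom H
  θ := K.θIso H
  D_mul_self g := SetLike.ext fun a => by rw [mem_dom_mul, and_self]
  D_mul_comm g h := SetLike.ext fun a => by rw [mem_dom_mul, mem_dom_mul, and_comm]
  mem_D_one := K.mem_dom_one H
  θ_one a := H.injective (by rw [map_θIso, K.θ_one (H.map_mem _)])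
  map_θ g h := by
    ext x
    simp only [Set.mem_image, Set.mem_ofPred_eq, SetLike.mem_coe, mem_dom_mul]
    constructor
    · rintro ⟨a, ha, rfl⟩
      exact ⟨SetLike.coe_mem _, (K.θIso_mem_iff H g h a).2 ha.2⟩
    · rintro ⟨hx, hx'⟩
      obtain ⟨a, ha⟩ := (K.θIso H g).toLinearEquiv.surjective ⟨x, hx⟩
      obtain rfl : _ = x := congrArg Subtype.val ha
      exact ⟨a, ⟨a.2, (K.θIso_mem_iff H g h a).1 hx'⟩, rfl⟩

theorem twist_one_left (g : G) : K.twist H 1 g = 1 :=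
  Units.ext <| Multiplier.ext
    (LinearMap.ext fun a => Subtype.ext <| H.injective <|
      (K.map_twist_right H 1 g a).trans (K.rightTwist_one_left (K.map_mem_of_mem_dom_mul H a)))
    (LinearMap.ext fun a => Subtype.ext <| H.injective <|
      (K.map_twist_left H 1 g a).trans (K.leftTwist_one_left (K.map_mem_of_mem_dom_mul H a)))

theorem twist_one_right (g : G) : K.twist H g 1 = 1 :=
  Units.ext <| Multiplier.ext
    (LinearMap.ext fun a => Subtype.ext <| H.injective <|
      (K.map_twist_right H g 1 a).trans (K.rightTwist_one_right (K.map_mem_of_mem_dom_mul H a)))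
    (LinearMap.ext fun a => Subtype.ext <| H.injective <|
      (K.map_twist_left H g 1 a).trans (K.leftTwist_one_right (K.map_mem_of_mem_dom_mul H a)))

theorem θIso_θIso_mem {g h : G} {a : A} (ha : a ∈ K.dom H h⁻¹ * K.dom H (h⁻¹ * g⁻¹)) :
    ((K.θIso H g).toLinearEquiv ⟨(K.θIso H h).toLinearEquiv ⟨a, AlgIdeal.mul_le_left ha⟩,
      (K.partialActionData H).conj_mem₁ ha⟩ : A) ∈ K.dom H g * K.dom H (g * h) :=
  (K.partialActionData H).θ_mem <|
    (K.mem_dom_mul H).2 ⟨(K.partialActionData H).conj_mem₁ ha, SetLike.coe_mem _⟩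

theorem twist_right_θIso_θIso {g h : G} {a : A}
    (ha : a ∈ K.dom H h⁻¹ * K.dom H (h⁻¹ * g⁻¹)) :
    (K.twist H g h).val.right ⟨_, K.θIso_θIso_mem H ha⟩ = (K.twist H g h).val.left
      ⟨(K.θIso H (g * h)).toLinearEquiv ⟨a, (K.partialActionData H).conj_mem₂ ha⟩,
        (K.partialActionData H).conj_mem₃ ha⟩ := by
  refine Subtype.ext (H.injective ?_)
  simp only [map_twist_right, map_twist_left, map_θIso]
  exact K.rightTwist_θ_θ (H.map_mem a) (AlgIdeal.mul_le_left ha)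
    ((K.partialActionData H).conj_mem₂ ha)

theorem twist_inv_right_twist_right (g h : G) (a : ↥(K.dom H g * K.dom H (g * h))) :
    (K.twist H g h)⁻¹.val.right ((K.twist H g h).val.right a) = a :=
  congrArg (fun m : Multiplier k _ => m.right a) (K.twist H g h).mul_inv

/-- The twisted partial action on `A` given by the formal units `u_g`. -/
def twistedPartialAction : TwistedPartialAction k G A where
  toPartialActionData := K.partialActionData H
  w := K.twist H
  conj g h a ha := congrArg Subtype.val <|
    (K.twist_inv_right_twist_right H g h ⟨_, K.θIso_θIso_mem H ha⟩).symm.trans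
      (congrArg (K.twist H g h)⁻¹.val.right (K.twist_right_θIso_θIso H ha))
  w_one_left := K.twist_one_left H
  w_one_right := K.twist_one_right H
  cocycle g h f a ha := H.injective <| by
    have haf : a ∈ K.dom H (h * f) := AlgIdeal.mul_le_right ha
    have hagh := (K.mem_dom_mul H).1 (AlgIdeal.mul_le_left ha)
    have hs : ι a ∈ supportedPart 𝓒 {1, g⁻¹, h, h * f} 1 := by
      simp [K.map_mem_supportedPart H, K.mem_dom_one H, hagh, haf]
    refine (K.map_twist_right H ..).trans <| .trans ?_ (K.map_twist_right H ..).symm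
    refine (congrArg _ ((K.map_θIso H ..).trans
      (congrArg _ (K.map_twist_right H ..)))).trans <|
      .trans (K.rightTwist_cocycle hs) (congrArg _ <| .symm <| (K.map_twist_right H ..).trans <|
        congrArg _ (K.map_θIso H ..))

theorem map_mulComponent_θIso (g h : G) (a : (K.twistedPartialAction H).D g⁻¹)
    (b : (K.twistedPartialAction H).D h) :
    ι ((K.twistedPartialAction H).mulComponent g h
      (((K.twistedPartialAction H).θ g).toLinearEquiv a) b) =
        K.rightTwist g h (K.θ g (ι a * ι b)) := by
  rw [TwistedPartialAction.mulComponent_θ, ← map_mul]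
  exact (K.map_twist_right H g h _).trans (congrArg (K.rightTwist g h) (K.map_θIso H g _))

theorem componentEquiv_mulComponent (g h : G) (a : (K.twistedPartialAction H).D g)
    (b : (K.twistedPartialAction H).D h) :
    (K.componentEquiv H (g * h) ((K.twistedPartialAction H).mulComponent g h a b) : C) =
      K.componentEquiv H g a * K.componentEquiv H h b := by
  obtain ⟨a, rfl⟩ := ((K.twistedPartialAction H).θ g).toLinearEquiv.surjective a
  calc (K.u (g * h)).rightMul (ι _)
      = (K.u (g * h)).rightMul (K.rightTwist g h (K.θ g (ι a * ι b))) :=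
        congrArg (K.u (g * h)).rightMul (K.map_mulComponent_θIso H g h a b)
    _ = (K.u g).rightMul (K.θ g (ι a)) * (K.u h).rightMul (ι b) :=
        K.rightMul_rightTwist_θ_mul (H.map_mem _) a.2 (H.map_mem _) b.2
    _ = _ := congrArg (fun c => (K.u g).rightMul c * (K.u h).rightMul (ι b))
        (K.map_θIso H g a).symm

variable [DecidableEq G] (internal : DirectSum.IsInternal 𝓒)

/-- The isomorphism `a δ_g ↦ a u_g` from the crossed product onto `C`. -/
def crossedProductEquiv : (K.twistedPartialAction H).CrossedProduct ≃ₗ[k] C :=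
  (DFinsupp.mapRange.linearEquiv (K.componentEquiv H) :
    (⨁ g, K.dom H g) ≃ₗ[k] ⨁ g, 𝓒 g).trans
      (LinearEquiv.ofBijective (DirectSum.coeLinearMap 𝓒) internal)

open TwistedPartialAction.CrossedProduct

theorem crossedProductEquiv_δ (g : G) (a : K.dom H g) :
    K.crossedProductEquiv H internal (δ (K.twistedPartialAction H) g a) =
      K.componentEquiv H g a := by
  change DirectSum.coeLinearMap 𝓒 (DFinsupp.mapRange.linearMap
    (fun g => (K.componentEquiv H g).toLinearMap) (DFinsupp.single g a)) = _
  rw [DFinsupp.mapRange.linearMap_apply, DFinsupp.mapRange_single]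
  exact DirectSum.coeLinearMap_lof 𝓒 g (K.componentEquiv H g a)

theorem crossedProductEquiv_mul (x y : (K.twistedPartialAction H).CrossedProduct) :
    K.crossedProductEquiv H internal (x * y) =
      K.crossedProductEquiv H internal x * K.crossedProductEquiv H internal y := by
  let ψ := (K.crossedProductEquiv H internal).toLinearMap
  have : (mulHom (K.twistedPartialAction H)).compr₂ ψ = (LinearMap.mul k C).compl₁₂ ψ ψ := by
    refine DirectSum.linearMap_ext k fun g => LinearMap.ext fun a =>
      DirectSum.linearMap_ext k fun h => LinearMap.ext fun b => ?_
    change ψ (δ _ g a * δ _ h b) = ψ (δ _ g a) * ψ (δ _ h b)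
    calc ψ (δ _ g a * δ _ h b)
        = ψ (δ _ (g * h) ((K.twistedPartialAction H).mulComponent g h a b)) :=
          congrArg ψ (δ_mul_δ _ g h a b)
      _ = K.componentEquiv H g a * K.componentEquiv H h b :=
          (K.crossedProductEquiv_δ H internal _ _).trans (K.componentEquiv_mulComponent H g h a b)
      _ = ψ (δ _ g a) * ψ (δ _ h b) :=
          (congrArg₂ (· * ·) (K.crossedProductEquiv_δ H internal g a)
            (K.crossedProductEquiv_δ H internal h b)).symm
  exact LinearMap.congr_fun₂ this x y

theorem map_crossedProductEquiv_symm (g : G) :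
    (𝓒 g).map ((K.crossedProductEquiv H internal).symm : C →ₗ[k] _) =
      LinearMap.range (δ (K.twistedPartialAction H) g) := by
  have symm_componentEquiv (a : K.dom H g) :
      (K.crossedProductEquiv H internal).symm (K.componentEquiv H g a) =
        δ (K.twistedPartialAction H) g a :=
    (LinearEquiv.symm_apply_eq _).2 (K.crossedProductEquiv_δ H internal g a).symm
  ext x
  constructor
  · rintro ⟨c, hc, rfl⟩
    obtain ⟨a, ha⟩ := (K.componentEquiv H g).surjective ⟨c, hc⟩
    exact ⟨a, (symm_componentEquiv a).symm.trans <|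
      congrArg (K.crossedProductEquiv H internal).symm (congrArg Subtype.val ha)⟩
  · rintro ⟨a, rfl⟩
    exact ⟨_, (K.componentEquiv H g a).2, symm_componentEquiv a⟩

/-- The isomorphism of algebras from `C` onto the crossed product. -/
def crossedProductIso : NAlgIso k C (K.twistedPartialAction H).CrossedProduct where
  toLinearEquiv := (K.crossedProductEquiv H internal).symm
  map_mul' a b := (K.crossedProductEquiv H internal).injective <| by
    change K.crossedProductEquiv H internal ((K.crossedProductEquiv H internal).symm (a * b)) =
      K.crossedProductEquiv H internal ((K.crossedProductEquiv H internal).symm a *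
        (K.crossedProductEquiv H internal).symm b)
    simp only [crossedProductEquiv_mul, LinearEquiv.apply_symm_apply]

end HomogeneousUnits

end CrossedProductDecomposition

namespace IsGrading

variable {k G B : Type*} [CommRing k] [Group G] [DecidableEq G] [NonUnitalRing B] [Module k B]
  [IsScalarTower k B B] [SMulCommClass k B B] {𝓑 : G → Submodule k B} {h𝓑 : IsGrading 𝓑}

theorem exists_isLocalUnitFamily (hE : h𝓑.HasEnoughLocalUnits) (g : G) :
    ∃ E : Set (h𝓑.prodComponent g), IsLocalUnitFamily (𝓑 g ⊙ 𝓑 g⁻¹) fun e : E => (e : B) :=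
  (hE g).exists_isLocalUnitFamily

theorem exists_isLocalUnitFamily_inv (hE : h𝓑.HasEnoughLocalUnits) (g : G) :
    ∃ E : Set (h𝓑.prodComponent g⁻¹), IsLocalUnitFamily (𝓑 g⁻¹ ⊙ 𝓑 g) fun e : E => (e : B) := by
  simpa only [inv_inv] using exists_isLocalUnitFamily hE g⁻¹

theorem isUnitalContext (hB : ∀ g, 𝓑 g ⊙ 𝓑 g⁻¹ ⊙ 𝓑 g = 𝓑 g) (hE : h𝓑.HasEnoughLocalUnits) (g : G) :
    IsUnitalContext (𝓑 g) (𝓑 g⁻¹) where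
  units_left := (exists_isLocalUnitFamily hE g).elim fun _ h => h.hasCommonUnits
  units_right := (exists_isLocalUnitFamily_inv hE g).elim fun _ h => h.hasCommonUnits
  mul_left := hB g
  mul_right := by simpa only [inv_inv] using hB g⁻¹

theorem nonempty_invertibleMultiplier_component (hB : ∀ g, 𝓑 g ⊙ 𝓑 g⁻¹ ⊙ 𝓑 g = 𝓑 g)
    (hE : h𝓑.HasEnoughLocalUnits) (g : G) :
    Nonempty (InvertibleMultiplier (FMat.component (B × ℕ) (𝓑 g))
      (FMat.component (B × ℕ) (𝓑 g⁻¹))) := by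
  obtain ⟨E, he⟩ := exists_isLocalUnitFamily hE g
  obtain ⟨E', he'⟩ := exists_isLocalUnitFamily_inv hE g
  exact FMat.nonempty_invertibleMultiplier_component (isUnitalContext hB hE g) he he'
    (((Function.Embedding.subtype _).trans (Function.Embedding.subtype _)).prodMap (.refl ℕ))
    (((Function.Embedding.subtype _).trans (Function.Embedding.subtype _)).prodMap (.refl ℕ))

theorem nonempty_homogeneousUnits (hB : ∀ g, 𝓑 g ⊙ 𝓑 g⁻¹ ⊙ 𝓑 g = 𝓑 g)
    (hE : h𝓑.HasEnoughLocalUnits) :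
    Nonempty (HomogeneousUnits fun g => FMat.component (B × ℕ) (𝓑 g)) := by
  have grading := FMat.isGrading_component (X := B × ℕ) h𝓑
  have exists_unit (g : G) : ∃ u : InvertibleMultiplier (FMat.component (B × ℕ) (𝓑 g))
      (FMat.component (B × ℕ) (𝓑 g⁻¹)),
      g = 1 → ∀ c ∈ ⊤ ⊙ FMat.component (B × ℕ) (𝓑 g⁻¹), u.rightMul c = c := by
    by_cases hg : g = 1
    · subst hg
      refine ⟨.ofEq (FMat.isUnitalContext_component (isUnitalContext hB hE 1)) (by rw [inv_one])
        (spanMul_le.2 fun a ha b hb => by simpa only [one_mul] using grading.mul_mem ha hb),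
        fun _ c hc => InvertibleMultiplier.rightMul_of_mem _ hc⟩
    · obtain ⟨u⟩ := nonempty_invertibleMultiplier_component hB hE g
      exact ⟨u, fun h => absurd h hg⟩
  choose u rightMul_one using exists_unit
  exact ⟨⟨grading.mul_mem, u, rightMul_one 1 rfl⟩⟩

end IsGrading

end

theorem theorem7p2 {k : Type v} {G : Type w} {B : Type u} [CommRing k] [Group G] [DecidableEq G]
    [NonUnitalRing B] [Module k B] [IsScalarTower k B B] [SMulCommClass k B B]
    (𝓑 : G → Submodule k B) (h𝓑 : IsGrading 𝓑)
    (hB : ∀ g : G, 𝓑 g ⊙ 𝓑 g⁻¹ ⊙ 𝓑 g = 𝓑 g)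
    (hE : h𝓑.HasEnoughLocalUnits) :
    ∃ (X : Type u) (_ : Infinite X)
      (Θ : TwistedPartialAction k G (FMat X h𝓑.unitComponent))
      (φ : NAlgIso k (FMat X B) Θ.CrossedProduct),
      ∀ g : G, (FMat.component X (𝓑 g)).map (φ.toLinearEquiv : FMat X B →ₗ[k] Θ.CrossedProduct) =
        LinearMap.range (TwistedPartialAction.CrossedProduct.δ Θ g) := by
  obtain ⟨K⟩ := IsGrading.nonempty_homogeneousUnits hB hE
  have identification : IsIdentification (FMat.subalgebraInclusion (B × ℕ) h𝓑.unitComponent)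
      (FMat.component (B × ℕ) (𝓑 1)) :=
    ⟨FMat.subalgebraInclusion_injective, FMat.mem_range_subalgebraInclusion⟩
  have internal := (FMat.isGrading_component (X := B × ℕ) h𝓑).internal
  exact ⟨B × ℕ, inferInstance, K.twistedPartialAction identification,
    K.crossedProductIso identification internal, K.map_crossedProductEquiv_symm _ internal⟩
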